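/- Let $X$ be a compact connected Riemann surface and $L\to X$ a holomorphic line bundle of degree $d_L$. An $L$-quadric bundle of type $(n,d)$ is a pair $(V,\gamma)$ of a holomorphic vector bundle $V$ on $X$ of rank $n$ and degree $d$ and a non-zero holomorphic section $\gamma$ of $S^2V^*\otimes L$, viewed as a symmetric map $\gamma:V\to V^*\otimes L$; $\operatorname{rk}(\gamma)$ denotes its generic rank. For a subbundle $W\subseteq V$ let $W^\perp$ be the kernel of $V^*\to W^*$. Let $\alpha\in\mathbb R$. Then $(V,\gamma)$ is $\alpha$-semistable if $\alpha\le d/n$ and (1) for every subbundle $0\ne V'\subsetneq V$: (a) if $\gamma(V')\not\subseteq V'^\perp\otimes L$, then $\deg V'\le d+\alpha(\operatorname{rk}V'-n)$; (b) if $\gamma(V')\subseteq V'^\perp\otimes L$, then $\deg V'\le \frac d2+\alpha(\operatorname{rk}V'-\frac n2)$; (c) if $\gamma(V')=0$, then $\deg V'\le\alpha\operatorname{rk}V'$; (2) for all subbundles $0\subsetneq V'\subsetneq V''\subsetneq V$ with $\gamma(V')\subseteq V''^\perp\otimes L$ and $\gamma(V'')\not\subseteq V''^\perp\otimes L$: $\deg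 V'+\deg V''\le d+\alpha(\operatorname{rk}V'+\operatorname{rk}V''-n)$. It is $\alpha$-polystable if it is $\alpha$-semistable and, whenever equality holds in one of these inequalities (for the respective $V'$, or $V'\subsetneq V''$), the following splitting into holomorphic subbundles exists: in (1), $V=V'\oplus B$ with, in the respective cases, (a) $\gamma(V',B)=\gamma(B,B)=0$; (b) $\gamma(V',V')=\gamma(B,B)=0$; (c) $\gamma(V',V')=\gamma(V',B)=0$; in (2), $V''=V'\oplus A$ and $V=V''\oplus B$ with $\gamma(V',V')=\gamma(V',A)=\gamma(A,B)=\gamma(B,B)=0$. Let $\mathcal N_\alpha(n,d)$ be the moduli space of $\alpha$-polystable $L$-quadric bundles of type $(n,d)$; its points are their isomorphism classes. **Proposition.** If $(V,\gamma)$ is an $\alpha$-semistable $L$-quadric bundle of type $(n,d)$, then $$n\alpha\le d\le \frac{\operatorname{rk}(\gamma)\,d_L}{2}+(n-\operatorname{rk}(\gamma))\,\alpha .$$ In particular, if $\alpha>d_L/2$, then for every $(n,d)$ there is no $\alpha$-semistable $L$-quadric bundle of type $(n,d)$, and $\mathcal N_\alpha(n,d)$ is empty. If $\alpha\le d_L/2$,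 then for all $(n,d)$ with $d>n d_L/2$ there is no $\alpha$-semistable $L$-quadric bundle of type $(n,d)$, and $\mathcal N_\alpha(n,d)$ is empty. -/

import Mathlib

open scoped Manifold ContDiff
open Bundle

universe u v w

/-- A holomorphic vector bundle of rank `n` over the Riemann surface `X`. -/
structure HolomorphicVectorBundle (X : Type u) [TopologicalSpace X] [ChartedSpace ℂ X]
    (n : ℕ) where
  /-- The fibre over a point. -/
  Fiber : X → Type v
  [topFiber : ∀ x, TopologicalSpace (Fiber x)]
  [groupFiber : ∀ x, AddCommGroup (Fiber x)]
  [moduleFiber : ∀ x, Module ℂ (Fiber x)]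
  [topTotal : TopologicalSpace (TotalSpace (Fin n → ℂ) Fiber)]
  [fiberBundle : FiberBundle (Fin n → ℂ) Fiber]
  [vectorBundle : VectorBundle ℂ (Fin n → ℂ) Fiber]
  [holomorphicBundle : ContMDiffVectorBundle ω (Fin n → ℂ) Fiber 𝓘(ℂ, ℂ)]

attribute [instance] HolomorphicVectorBundle.topFiber HolomorphicVectorBundle.groupFiber
  HolomorphicVectorBundle.moduleFiber HolomorphicVectorBundle.topTotal
  HolomorphicVectorBundle.fiberBundle HolomorphicVectorBundle.vectorBundle
  HolomorphicVectorBundle.holomorphicBundle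

namespace HolomorphicVectorBundle

variable {X : Type u} [TopologicalSpace X] [ChartedSpace ℂ X] {n : ℕ}

/-- The section `s` of `V` is holomorphic on `U` (used for open `U` only). -/
def IsHolomorphicOn (V : HolomorphicVectorBundle.{u, v} X n) (s : ∀ x, V.Fiber x)
    (U : Set X) : Prop :=
  ContMDiffOn 𝓘(ℂ, ℂ) (𝓘(ℂ, ℂ).prod 𝓘(ℂ, Fin n → ℂ)) ω
    (fun x => (TotalSpace.mk' (Fin n → ℂ) x (s x) : TotalSpace (Fin n → ℂ) V.Fiber)) U

/-- `s₁, …, s_k` is a holomorphic frame over the open set `U` of the family `W` of subspaces of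
the fibres of `V`. -/
structure IsHolomorphicFrame (V : HolomorphicVectorBundle.{u, v} X n) {k : ℕ}
    (W : ∀ x, Submodule ℂ (V.Fiber x)) (s : Fin k → ∀ x, V.Fiber x) (U : Set X) : Prop where
  isOpen : IsOpen U
  holomorphic : ∀ i, V.IsHolomorphicOn (s i) U
  linearIndependent : ∀ x ∈ U, LinearIndependent ℂ (fun i => s i x)
  span_eq : ∀ x ∈ U, Submodule.span ℂ (Set.range (fun i => s i x)) = W x

/-- A holomorphic vector subbundle of `V`: a family of subspaces of the fibres which has, near
every point, a holomorphic frame. -/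
structure Subbundle (V : HolomorphicVectorBundle.{u, v} X n) where
  /-- The fibres of the subbundle. -/
  carrier : ∀ x, Submodule ℂ (V.Fiber x)
  /-- The rank of the subbundle. -/
  rank : ℕ
  exists_frame : ∀ x, ∃ (s : Fin rank → ∀ y, V.Fiber y) (U : Set X),
    x ∈ U ∧ V.IsHolomorphicFrame carrier s U

/-- The whole bundle `V`, as a subbundle of itself. -/
def whole (V : HolomorphicVectorBundle.{u, v} X n) : V.Subbundle where
  carrier := ⊤
  rank := n
  exists_frame x := by
    let e := trivializationAt (Fin n → ℂ) V.Fiber x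
    have he := e.isLocalFrameOn_localFrame_baseSet 𝓘(ℂ, ℂ) ω (Pi.basisFun ℂ (Fin n))
    refine ⟨e.localFrame (Pi.basisFun ℂ (Fin n)), e.baseSet,
      FiberBundle.mem_baseSet_trivializationAt' x, e.open_baseSet, fun i => he.contMDiffOn i,
      fun y hy => he.linearIndependent hy, fun y hy => ?_⟩
    exact top_le_iff.mp (he.generating hy)

/-- A smooth Hermitian metric on `V`. -/
structure HermitianMetric (V : HolomorphicVectorBundle.{u, v} X n) where
  /-- The Hermitian form on the fibre over a point, conjugate linear in the first variable. -/
  form : ∀ x, V.Fiber x →ₗ⋆[ℂ] V.Fiber x →ₗ[ℂ] ℂ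
  conj_symm : ∀ x a b, starRingEnd ℂ (form x a b) = form x b a
  pos : ∀ x a, a ≠ 0 → 0 < (form x a a).re
  /-- The form is `C^∞` in the real sense: it is so on local holomorphic sections. -/
  smooth : ∀ (U : Set X) (s t : ∀ x, V.Fiber x), IsOpen U →
    V.IsHolomorphicOn s U → V.IsHolomorphicOn t U →
    ContMDiffOn 𝓘(ℝ, ℂ) 𝓘(ℝ, ℂ) ∞ (fun x => form x (s x) (t x)) U

namespace Subbundle

variable {V : HolomorphicVectorBundle.{u, v} X n}

/-- A holomorphic frame of the subbundle `W` near `x`. -/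
noncomputable def frame (W : V.Subbundle) (x : X) : Fin W.rank → ∀ y, V.Fiber y :=
  (W.exists_frame x).choose

/-- The squared norm `det (h(sᵢ, sⱼ))` of the local section `s₁ ∧ … ∧ s_k` of `det W`, where
`s₁, …, s_k` is the chosen frame of `W` near `x` and `W` carries the metric induced by `h`. -/
noncomputable def gramDet (W : V.Subbundle) (h : V.HermitianMetric) (x y : X) : ℝ :=
  (Matrix.det (Matrix.of fun i j => h.form y (W.frame x i y) (W.frame x j y))).re

/-- The first Chern form of `W` with the metric induced by `h` is, for any holomorphic frame,
`(i/2π) ∂̄∂ log det (h(sᵢ, sⱼ)) = -(1/4π) Δ(log det (h(sᵢ, sⱼ))) dx ∧ dy`, which does not depend on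
the frame. This is its coefficient with respect to `dx ∧ dy` at the point `z` of the chart
around `p`. -/
noncomputable def chernCoeff (W : V.Subbundle) (h : V.HermitianMetric) (p : X) (z : ℂ) : ℝ :=
  -(1 / (4 * Real.pi)) *
    Laplacian.laplacian
      (fun z' : ℂ => Real.log (W.gramDet h ((chartAt ℂ p).symm z) ((chartAt ℂ p).symm z'))) z

/-- The integral over `X` of the first Chern form of `W`, computed in charts through a partition
of unity `ρ` that is subordinate to them. -/
noncomputable def chernIntegral (W : V.Subbundle) (h : V.HermitianMetric)
    (ρ : SmoothPartitionOfUnity X 𝓘(ℝ, ℂ) X Set.univ) : ℝ :=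
  ∑ᶠ p : X, ∫ z in (chartAt ℂ p).target, ρ p ((chartAt ℂ p).symm z) * W.chernCoeff h p z

/-- The degree of `W`: the integral over `X` of the first Chern form of a smooth Hermitian
metric. On a compact Riemann surface there are such metrics and partitions of unity, and the
integral does not depend on them. -/
noncomputable def degree (W : V.Subbundle) : ℝ :=
  Classical.epsilon fun c : ℝ => ∃ (h : V.HermitianMetric)
    (ρ : SmoothPartitionOfUnity X 𝓘(ℝ, ℂ) X Set.univ),
      ρ.IsSubordinate (fun p => (chartAt ℂ p).source) ∧ W.chernIntegral h ρ = c

end Subbundle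

/-- The degree of a holomorphic vector bundle. -/
noncomputable def degree (V : HolomorphicVectorBundle.{u, v} X n) : ℝ := V.whole.degree

end HolomorphicVectorBundle

/-- An `L`-quadric bundle of rank `n`: a holomorphic vector bundle `V` of rank `n` with a non-zero
holomorphic section `γ` of `S²V* ⊗ L`, seen as a symmetric holomorphic map `V → V* ⊗ L`. -/
structure QuadricBundle {X : Type u} [TopologicalSpace X] [ChartedSpace ℂ X]
    (L : HolomorphicVectorBundle.{u, w} X 1) (n : ℕ) where
  /-- The underlying vector bundle. -/
  V : HolomorphicVectorBundle.{u, v} X n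
  /-- The `L`-valued quadratic form. -/
  γ : ∀ x, V.Fiber x →ₗ[ℂ] V.Fiber x →ₗ[ℂ] L.Fiber x
  symm : ∀ x a b, γ x a b = γ x b a
  holomorphic : ∀ (U : Set X) (s t : ∀ x, V.Fiber x), IsOpen U →
    V.IsHolomorphicOn s U → V.IsHolomorphicOn t U →
    L.IsHolomorphicOn (fun x => γ x (s x) (t x)) U
  ne_zero : ∃ x, γ x ≠ 0

namespace QuadricBundle

variable {X : Type u} [TopologicalSpace X] [ChartedSpace ℂ X]
  {L : HolomorphicVectorBundle.{u, w} X 1} {n : ℕ}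

/-- The degree of the underlying vector bundle. -/
noncomputable def degree (Q : QuadricBundle.{u, v, w} L n) : ℝ := Q.V.degree

/-- The rank of `γ : V → V* ⊗ L`, that is, its rank at a general point of `X`, which is the
largest of its ranks at the points of `X`. -/
noncomputable def rankγ (Q : QuadricBundle.{u, v, w} L n) : ℕ :=
  ⨆ x, Module.finrank ℂ (LinearMap.range (Q.γ x))

/-- The fibre at `x` of `W^⊥ ⊗ L`, as a subspace of `V* ⊗ L = Hom(V, L)`. -/
def perp (Q : QuadricBundle.{u, v, w} L n) (W : Q.V.Subbundle) (x : X) :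
    Submodule ℂ (Q.V.Fiber x →ₗ[ℂ] L.Fiber x) where
  carrier := {f | ∀ a ∈ W.carrier x, f a = 0}
  add_mem' hf hg a ha := by simp [hf a ha, hg a ha]
  zero_mem' _ _ := rfl
  smul_mem' c f hf a ha := by simp [hf a ha]

/-- `γ(W) ⊆ W'^⊥ ⊗ L`. -/
def MapsToPerp (Q : QuadricBundle.{u, v, w} L n) (W W' : Q.V.Subbundle) : Prop :=
  ∀ x, (W.carrier x).map (Q.γ x) ≤ Q.perp W' x

/-- `γ(W) = 0`. -/
def MapsToZero (Q : QuadricBundle.{u, v, w} L n) (W : Q.V.Subbundle) : Prop :=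
  ∀ x, (W.carrier x).map (Q.γ x) = ⊥

/-- `0 ⊊ W ⊊ V`. -/
def IsProper (Q : QuadricBundle.{u, v, w} L n) (W : Q.V.Subbundle) : Prop :=
  ⊥ < W.carrier ∧ W.carrier < ⊤

/-- `0 ⊊ W ⊊ W' ⊊ V` is a strict filtration such that `γ(W) ⊆ W'^⊥ ⊗ L` and
`γ(W') ⊄ W'^⊥ ⊗ L`. -/
def IsSpecialFiltration (Q : QuadricBundle.{u, v, w} L n) (W W' : Q.V.Subbundle) : Prop :=
  ⊥ < W.carrier ∧ W.carrier < W'.carrier ∧ W'.carrier < ⊤ ∧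
    Q.MapsToPerp W W' ∧ ¬ Q.MapsToPerp W' W'

/-- `α`-semistability. -/
def IsSemistable (Q : QuadricBundle.{u, v, w} L n) (α : ℝ) : Prop :=
  α ≤ Q.degree / n ∧
  (∀ W : Q.V.Subbundle, Q.IsProper W →
    (¬ Q.MapsToPerp W W → W.degree ≤ Q.degree + α * ((W.rank : ℝ) - n)) ∧
    (Q.MapsToPerp W W → W.degree ≤ Q.degree / 2 + α * ((W.rank : ℝ) - n / 2)) ∧
    (Q.MapsToZero W → W.degree ≤ α * W.rank)) ∧
  (∀ W W' : Q.V.Subbundle, Q.IsSpecialFiltration W W' →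
    W.degree + W'.degree ≤ Q.degree + α * ((W.rank : ℝ) + W'.rank - n))

/-- `V = A ⊕ B`. -/
def IsDirectSum (Q : QuadricBundle.{u, v, w} L n) (A B : Q.V.Subbundle) : Prop :=
  ∀ x, IsCompl (A.carrier x) (B.carrier x)

/-- `γ` vanishes on `A ⊗ B`, that is, the block of `γ` at the place `(A, B)` is zero. -/
def BlockZero (Q : QuadricBundle.{u, v, w} L n) (A B : Q.V.Subbundle) : Prop :=
  ∀ x, ∀ a ∈ A.carrier x, ∀ b ∈ B.carrier x, Q.γ x a b = 0

/-- `α`-polystability: `α`-semistability, and in each case of equality the bundle splits with `γ`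
in block form. As `γ ≠ 0`, the blocks not required to vanish are not all zero. -/
def IsPolystable (Q : QuadricBundle.{u, v, w} L n) (α : ℝ) : Prop :=
  Q.IsSemistable α ∧
  (∀ W : Q.V.Subbundle, Q.IsProper W →
    (¬ Q.MapsToPerp W W → W.degree = Q.degree + α * ((W.rank : ℝ) - n) →
      ∃ B : Q.V.Subbundle, Q.IsDirectSum W B ∧ Q.BlockZero W B ∧ Q.BlockZero B B) ∧
    (Q.MapsToPerp W W → W.degree = Q.degree / 2 + α * ((W.rank : ℝ) - n / 2) →
      ∃ B : Q.V.Subbundle, Q.IsDirectSum W B ∧ Q.BlockZero W W ∧ Q.BlockZero B B) ∧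
    (Q.MapsToZero W → W.degree = α * W.rank →
      ∃ B : Q.V.Subbundle, Q.IsDirectSum W B ∧ Q.BlockZero W W ∧ Q.BlockZero W B)) ∧
  (∀ W W' : Q.V.Subbundle, Q.IsSpecialFiltration W W' →
    W.degree + W'.degree = Q.degree + α * ((W.rank : ℝ) + W'.rank - n) →
      ∃ A B : Q.V.Subbundle,
        (∀ x, Disjoint (W.carrier x) (A.carrier x) ∧
          W.carrier x ⊔ A.carrier x = W'.carrier x) ∧
        Q.IsDirectSum W' B ∧
        Q.BlockZero W W ∧ Q.BlockZero W A ∧ Q.BlockZero A B ∧ Q.BlockZero B B)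

/-- A fibrewise linear map `V → V'` is holomorphic: it takes local holomorphic sections to local
holomorphic sections. -/
def IsHolomorphicMap {m : ℕ} (V : HolomorphicVectorBundle.{u, v} X n)
    (V' : HolomorphicVectorBundle.{u, v} X m)
    (f : ∀ x, V.Fiber x →ₗ[ℂ] V'.Fiber x) : Prop :=
  ∀ (U : Set X) (s : ∀ x, V.Fiber x), IsOpen U → V.IsHolomorphicOn s U →
    V'.IsHolomorphicOn (fun x => f x (s x)) U

/-- `(V, γ)` and `(V', γ')` are isomorphic: there is an isomorphism `f : V → V'` of holomorphic
vector bundles with `γ = (fᵗ ⊗ id) γ' f`. -/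
def IsIso (Q Q' : QuadricBundle.{u, v, w} L n) : Prop :=
  ∃ f : ∀ x, Q.V.Fiber x ≃ₗ[ℂ] Q'.V.Fiber x,
    IsHolomorphicMap Q.V Q'.V (fun x => (f x).toLinearMap) ∧
    IsHolomorphicMap Q'.V Q.V (fun x => (f x).symm.toLinearMap) ∧
    ∀ x a b, Q'.γ x (f x a) (f x b) = Q.γ x a b

theorem isIso_equivalence : Equivalence (IsIso (L := L) (n := n)) where
  refl Q := ⟨fun x => LinearEquiv.refl ℂ _, fun _ _ _ hs => hs, fun _ _ _ hs => hs,
    fun _ _ _ => rfl⟩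
  symm := by
    rintro Q Q' ⟨f, h1, h2, h3⟩
    refine ⟨fun x => (f x).symm, h2, h1, fun x a b => ?_⟩
    rw [← h3]; simp
  trans := by
    rintro Q Q' Q'' ⟨f, h1, h2, h3⟩ ⟨g, k1, k2, k3⟩
    refine ⟨fun x => (f x).trans (g x), fun U s hU hs => k1 U _ hU (h1 U s hU hs),
      fun U s hU hs => h2 U _ hU (k2 U s hU hs), fun x a b => ?_⟩
    rw [← h3, ← k3]; rfl

/-- The `α`-polystable `L`-quadric bundles of type `(n, d)`. -/
def Polystable (L : HolomorphicVectorBundle.{u, w} X 1) (α : ℝ) (n : ℕ) (d : ℤ) :=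
  {Q : QuadricBundle.{u, v, w} L n // Q.degree = d ∧ Q.IsPolystable α}

/-- Isomorphism of `α`-polystable quadric bundles. -/
def isoSetoid (L : HolomorphicVectorBundle.{u, w} X 1) (α : ℝ) (n : ℕ) (d : ℤ) :
    Setoid (Polystable.{u, v, w} L α n d) :=
  Setoid.comap Subtype.val ⟨IsIso, isIso_equivalence⟩

/-- The set of points of the moduli space `N_α(n, d)`: the isomorphism classes of `α`-polystable
`L`-quadric bundles of type `(n, d)`. -/
def ModuliSpace (L : HolomorphicVectorBundle.{u, w} X 1) (α : ℝ) (n : ℕ) (d : ℤ) :=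
  Quotient (isoSetoid.{u, v, w} L α n d)

end QuadricBundle

/-! ### The Laplacian in the plane: conformal invariance, convexity, vanishing integral. -/

section PlaneCalculus

open Filter Topology MeasureTheory Complex

/-! Let `N` be the saturation of the kernel of `γ` and `r` the generic rank, so that `N` is a
holomorphic subbundle of rank `n - r`. The form that `γ` induces on `V / N` is nondegenerate off
isolated points, and its discriminant is a non-zero holomorphic section of `L ^ r ⊗ det (V / N) ^
(-2)`. A line bundle with a non-zero section has non-negative degree, so `2 (d - deg N) ≤ r d_L`
(`two_mul_degree_le`). Since `γ` vanishes on `N`, condition (1c) gives `deg N ≤ α (n - r)`; the case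
`N = 0` is trivial (`kernelBundle_degree_le`). Adding the two gives the upper bound, and the lower
one is the condition `α ≤ d / n`. The emptiness statements follow because `r > 0`.

The degree is an integral of curvature, so the positivity of degrees is proved analytically. The
squared norm of a section is locally `Φ = |G|² e^w` with `G` holomorphic, and minus the curvature
is, up to a positive factor, `Δ w`. Convexity of `t ↦ log (e^t + ε)` and harmonicity of `log |G|`
give `Φ / (Φ + ε) · Δ w ≤ Δ log (Φ + ε)`. The right side integrates to zero by Stokes, and `ε → 0`
yields `∫ Δ w ≤ 0` (`IsSingularPotential.chartIntegral_nonpos`). With `G = 1` the same inequality,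
applied in both directions, shows that the degree is independent of the metric (`chernIntegral_le`,
`degree_eq_chernIntegral`). No quotient bundle, determinant bundle or tensor power is constructed:
the discriminant enters only through its squared norm, a function on `X` written with frames of `V`
adapted to `N`.

That `N` is a subbundle is Gaussian elimination over the discrete valuation ring of germs of
holomorphic functions (`exists_saturated_kernel`). -/

theorem laplacian_eq_fderiv_fderiv (f : ℂ → ℝ) (z : ℂ) :
    Laplacian.laplacian f z =
      fderiv ℝ (fderiv ℝ f) z 1 1 + fderiv ℝ (fderiv ℝ f) z I I := by
  rw [InnerProductSpace.laplacian_eq_iteratedFDeriv_complexPlane]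
  simp [iteratedFDeriv_two_apply]

/-- Multiplication by `a` is a rotation followed by scaling by `‖a‖`. The mixed terms of the two
summands cancel, so `B` need not be symmetric. -/
theorem bilin_conformal (B : ℂ →L[ℝ] ℂ →L[ℝ] ℝ) (a : ℂ) :
    B (a * 1) (a * 1) + B (a * I) (a * I) = ‖a‖ ^ 2 * (B 1 1 + B I I) := by
  have h1 : a * 1 = a.re • (1 : ℂ) + a.im • I := by
    apply Complex.ext <;> simp
  have h2 : a * I = (-a.im) • (1 : ℂ) + a.re • I := by
    apply Complex.ext <;> simp
  rw [h1, h2, ← Complex.normSq_eq_norm_sq, Complex.normSq_apply]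
  simp only [map_add, map_smul, add_apply, smul_apply,
    smul_eq_mul]
  ring

/-- The Laplacian of the plane is conformally invariant. -/
theorem laplacian_comp_analytic {f : ℂ → ℝ} {g : ℂ → ℂ} {z : ℂ}
    (hf : ContDiffAt ℝ 2 f (g z)) (hg : AnalyticAt ℂ g z) :
    Laplacian.laplacian (fun y => f (g y)) z =
      ‖deriv g z‖ ^ 2 * Laplacian.laplacian f (g z) := by
  have hfd : ∀ᶠ y in 𝓝 z, DifferentiableAt ℝ f (g y) := by
    have := hf.eventually (by simp)
    filter_upwards [hg.continuousAt.eventually this] with y hy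
    exact hy.differentiableAt (by simp)
  have hgd : ∀ᶠ y in 𝓝 z, DifferentiableAt ℂ g y :=
    hg.eventually_analyticAt.mono fun y hy => hy.differentiableAt
  have h1 : ∀ᶠ y in 𝓝 z, fderiv ℝ (fun y => f (g y)) y =
      (fderiv ℝ f (g y)).comp (((1 : ℂ →L[ℂ] ℂ).smulRight (deriv g y)).restrictScalars ℝ) := by
    filter_upwards [hfd, hgd] with y h1 h2
    have h3 : HasFDerivAt g (((1 : ℂ →L[ℂ] ℂ).smulRight (deriv g y)).restrictScalars ℝ) y :=
      (h2.hasDerivAt.hasFDerivAt).restrictScalars ℝ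
    exact (h1.hasFDerivAt.comp y h3).fderiv
  have hd1 : DifferentiableAt ℝ (fderiv ℝ f) (g z) :=
    (hf.fderiv_right (m := 1) (by norm_num)).differentiableAt (by simp)
  have hg' : HasFDerivAt g (((1 : ℂ →L[ℂ] ℂ).smulRight (deriv g z)).restrictScalars ℝ) z :=
    (hg.differentiableAt.hasDerivAt.hasFDerivAt).restrictScalars ℝ
  have hg'' : HasFDerivAt (deriv g)
      (((1 : ℂ →L[ℂ] ℂ).smulRight (deriv (deriv g) z)).restrictScalars ℝ) z :=
    (hg.deriv.differentiableAt.hasDerivAt.hasFDerivAt).restrictScalars ℝ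
  -- Second-order chain rule: a Hessian term in the direction `g' v`, and the gradient of `f` paired
  -- with `g'' v²`.
  have key : ∀ v : ℂ, fderiv ℝ (fderiv ℝ (fun y => f (g y))) z v v =
      fderiv ℝ (fderiv ℝ f) (g z) (deriv g z * v) (deriv g z * v) +
        fderiv ℝ f (g z) (v * v * deriv (deriv g) z) := by
    intro v
    have hdd : DifferentiableAt ℝ (fderiv ℝ (fun y => f (g y))) z := by
      have : ContDiffAt ℝ 2 (fun y => f (g y)) z :=
        hf.comp z (hg.contDiffAt.restrict_scalars ℝ)
      exact (this.fderiv_right (m := 1) (by norm_num)).differentiableAt (by simp)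
    have e1 : fderiv ℝ (fderiv ℝ (fun y => f (g y))) z v v =
        fderiv ℝ (fun y => fderiv ℝ (fun y => f (g y)) y v) z v := by
      rw [fderiv_clm_apply hdd (by fun_prop)]
      simp
    rw [e1]
    have e2 : (fun y => fderiv ℝ (fun y => f (g y)) y v) =ᶠ[𝓝 z]
        fun y => fderiv ℝ f (g y) (v * deriv g y) := by
      filter_upwards [h1] with y hy
      rw [hy]; simp
    rw [e2.fderiv_eq]
    have e3 : HasFDerivAt (fun y => fderiv ℝ f (g y)) ((fderiv ℝ (fderiv ℝ f) (g z)).comp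
        (((1 : ℂ →L[ℂ] ℂ).smulRight (deriv g z)).restrictScalars ℝ)) z :=
      hd1.hasFDerivAt.comp z hg'
    have e4 := e3.clm_apply (hg''.const_mul v)
    rw [e4.fderiv]
    simp [mul_comm, mul_left_comm, add_comm]
  rw [laplacian_eq_fderiv_fderiv, laplacian_eq_fderiv_fderiv, key, key,
    ← bilin_conformal (fderiv ℝ (fderiv ℝ f) (g z)) (deriv g z)]
  -- The gradient terms for `v = 1` and `v = I` cancel because `I² = -1`; this is the harmonicity of
  -- `g`.
  have : fderiv ℝ f (g z) (I * I * deriv (deriv g) z) =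
      - fderiv ℝ f (g z) (1 * 1 * deriv (deriv g) z) := by
    rw [← map_neg]; congr 1; simp
  rw [this]; ring

/-- For convex `F`, `Δ (F ∘ W) ≥ F'(W) Δ W`. -/
theorem le_laplacian_comp_of_convex {F F' F'' : ℝ → ℝ} {W : ℂ → ℝ} {z : ℂ}
    (hF : ∀ t, HasDerivAt F (F' t) t) (hF' : ∀ t, HasDerivAt F' (F'' t) t)
    (hF'' : ∀ t, 0 ≤ F'' t) (hW : ContDiffAt ℝ 2 W z) :
    F' (W z) * Laplacian.laplacian W z ≤ Laplacian.laplacian (fun y => F (W y)) z := by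
  have hWd : ∀ᶠ y in 𝓝 z, DifferentiableAt ℝ W y :=
    (hW.eventually (by simp)).mono fun y hy => hy.differentiableAt (by simp)
  have hd1 : DifferentiableAt ℝ (fderiv ℝ W) z :=
    (hW.fderiv_right (m := 1) (by norm_num)).differentiableAt (by simp)
  have key : ∀ v : ℂ, fderiv ℝ (fderiv ℝ (fun y => F (W y))) z v v =
      F' (W z) * fderiv ℝ (fderiv ℝ W) z v v + F'' (W z) * (fderiv ℝ W z v) ^ 2 := by
    intro v
    have e2 : fderiv ℝ (fun y => F (W y)) =ᶠ[𝓝 z] fun y => F' (W y) • fderiv ℝ W y := by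
      filter_upwards [hWd] with y hy
      exact ((hF (W y)).comp_hasFDerivAt y hy.hasFDerivAt).fderiv
    rw [e2.fderiv_eq]
    have e4 := ((hF' (W z)).comp_hasFDerivAt z hWd.self_of_nhds.hasFDerivAt).smul hd1.hasFDerivAt
    have e5 : fderiv ℝ (fun y => F' (W y) • fderiv ℝ W y) z = _ := e4.fderiv
    rw [e5]
    simp
    ring
  rw [laplacian_eq_fderiv_fderiv, laplacian_eq_fderiv_fderiv, key, key]
  -- These are the two parts of `F''(W) |∇W|²`, the only term that the inequality discards.
  have h1 := mul_nonneg (hF'' (W z)) (sq_nonneg (fderiv ℝ W z 1))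
  have h2 := mul_nonneg (hF'' (W z)) (sq_nonneg (fderiv ℝ W z I))
  linarith

/-- The integral over the plane of the Laplacian of a compactly supported function vanishes. -/
theorem integral_laplacian_eq_zero {f : ℂ → ℝ} (hf : ContDiff ℝ 2 f)
    (hc : HasCompactSupport f) : ∫ z, Laplacian.laplacian f z = 0 := by
  have hf1 : ContDiff ℝ 1 (fderiv ℝ f) := hf.fderiv_right (by norm_num)
  have hc1 : HasCompactSupport (fderiv ℝ f) := hc.fderiv ℝ
  have hc2 : HasCompactSupport (fderiv ℝ (fderiv ℝ f)) := hc1.fderiv ℝ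
  have hcont : Continuous (fderiv ℝ (fderiv ℝ f)) := hf1.continuous_fderiv (by simp)
  have hint : ∀ v : ℂ, Integrable (fun z => fderiv ℝ (fderiv ℝ f) z v v) := by
    intro v
    apply Continuous.integrable_of_hasCompactSupport (by fun_prop)
    exact hc2.mono fun z hz => by
      contrapose! hz
      simp only [Function.mem_support, not_not] at hz ⊢
      simp [hz]
  have hcont1 : Continuous (fderiv ℝ f) := hf1.continuous
  have hint1 : ∀ v : ℂ, Integrable (fun z => fderiv ℝ f z v) := by
    intro v
    apply Continuous.integrable_of_hasCompactSupport (by fun_prop)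
    exact hc1.mono fun z hz => by
      contrapose! hz
      simp only [Function.mem_support, not_not] at hz ⊢
      simp [hz]
  have key : ∀ v : ℂ, ∫ z, fderiv ℝ (fderiv ℝ f) z v v = 0 := by
    intro v
    have e : ∀ z, fderiv ℝ (fderiv ℝ f) z v v = fderiv ℝ (fun y => fderiv ℝ f y v) z v := by
      intro z
      rw [fderiv_clm_apply (hf1.differentiable (by simp) z) (by fun_prop)]
      simp
    -- Integration by parts against the constant function `1`.
    have := integral_mul_fderiv_eq_neg_fderiv_mul_of_integrable (μ := (volume : Measure ℂ))
      (f := fun _ : ℂ => (1 : ℝ)) (g := fun y => fderiv ℝ f y v) (v := v) (by simp)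
      (by simpa only [one_mul, ← e] using hint v) (by simpa using hint1 v) (by fun_prop)
      (fun x _ => (hf1.differentiable (by simp) x).clm_apply (by fun_prop))
    simpa [← e] using this
  simp_rw [laplacian_eq_fderiv_fderiv]
  rw [integral_add (hint 1) (hint I), key, key, add_zero]

/-- The function `t ↦ log (e^t + ε)` together with its two derivatives. -/
theorem hasDerivAt_log_exp_add {ε : ℝ} (hε : 0 < ε) (t : ℝ) :
    HasDerivAt (fun t => Real.log (Real.exp t + ε)) (Real.exp t / (Real.exp t + ε)) t := by
  have h : Real.exp t + ε ≠ 0 := by positivity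
  exact ((Real.hasDerivAt_exp t).add_const ε).log h

theorem hasDerivAt_exp_div_exp_add {ε : ℝ} (hε : 0 < ε) (t : ℝ) :
    HasDerivAt (fun t => Real.exp t / (Real.exp t + ε))
      (ε * Real.exp t / (Real.exp t + ε) ^ 2) t := by
  have h : Real.exp t + ε ≠ 0 := by positivity
  refine ((Real.hasDerivAt_exp t).div ((Real.hasDerivAt_exp t).add_const ε) h).congr_deriv ?_
  ring

/-- If `Φ = |G|² e^w` with `G` holomorphic, then `Δ log (Φ + ε) ≥ Φ / (Φ + ε) · Δ w` away from the
zeros of `G`. -/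
theorem le_laplacian_log_add {G : ℂ → ℂ} {w Φ : ℂ → ℝ} {z : ℂ} {ε : ℝ} (hε : 0 < ε)
    (hG : AnalyticAt ℂ G z) (hG0 : G z ≠ 0) (hw : ContDiffAt ℝ 2 w z)
    (hΦ : ∀ᶠ y in 𝓝 z, Φ y = ‖G y‖ ^ 2 * Real.exp (w y)) :
    Φ z / (Φ z + ε) * Laplacian.laplacian w z ≤
      Laplacian.laplacian (fun y => Real.log (Φ y + ε)) z := by
  have hharm : InnerProductSpace.HarmonicAt (fun y => Real.log ‖G y‖) z :=
    hG.harmonicAt_log_norm hG0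
  have hW0 : ContDiffAt ℝ 2 (fun y => Real.log ‖G y‖) z := hharm.1
  -- Near `z` one has `Φ = e^W`, and `Δ W = Δ w` because `log ‖G‖` is harmonic where `G ≠ 0`.
  set W : ℂ → ℝ := fun y => w y + (2 : ℝ) • Real.log ‖G y‖ with hWdef
  have hW : ContDiffAt ℝ 2 W z := by
    apply hw.add
    exact hW0.const_smul (2 : ℝ)
  have hΦW : ∀ᶠ y in 𝓝 z, Φ y = Real.exp (W y) := by
    filter_upwards [hΦ, hG.continuousAt.eventually_ne hG0] with y hy hy0
    have : (0 : ℝ) < ‖G y‖ := norm_pos_iff.2 hy0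
    rw [hy, hWdef]
    simp only [smul_eq_mul]
    rw [Real.exp_add, two_mul, Real.exp_add, Real.exp_log this]
    ring
  have hlapW : Laplacian.laplacian W z = Laplacian.laplacian w z := by
    have h1 : Laplacian.laplacian W z = Laplacian.laplacian w z +
        Laplacian.laplacian ((2 : ℝ) • fun y => Real.log ‖G y‖) z :=
      hw.laplacian_add (f₂ := (2 : ℝ) • fun y => Real.log ‖G y‖) (hW0.const_smul (2 : ℝ))
    rw [h1, InnerProductSpace.laplacian_smul (2 : ℝ) hW0, hharm.2.eq_of_nhds]
    simp
  have hcongr : Laplacian.laplacian (fun y => Real.log (Φ y + ε)) z =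
      Laplacian.laplacian (fun y => Real.log (Real.exp (W y) + ε)) z := by
    apply (InnerProductSpace.laplacian_congr_nhds _).eq_of_nhds
    filter_upwards [hΦW] with y hy
    rw [hy]
  rw [hcongr, ← hlapW, hΦW.self_of_nhds]
  exact le_laplacian_comp_of_convex (F := fun t => Real.log (Real.exp t + ε))
    (hasDerivAt_log_exp_add hε) (hasDerivAt_exp_div_exp_add hε) (fun t => by positivity) hW

end PlaneCalculus

/-! ### Integration of 2-forms over a surface through charts. -/

section Charts

open Filter Topology MeasureTheory Complex

theorem contDiffAt_comp_chartAt_symm {𝕜 E F M : Type*} [NontriviallyNormedField 𝕜]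
    [NormedAddCommGroup E] [NormedSpace 𝕜 E] [NormedAddCommGroup F] [NormedSpace 𝕜 F]
    [TopologicalSpace M] [ChartedSpace E M] {n : ℕ∞ω} [IsManifold 𝓘(𝕜, E) n M] {f : M → F} {p : M}
    {z : E} (hz : z ∈ (chartAt E p).target)
    (hf : ContMDiffAt 𝓘(𝕜, E) 𝓘(𝕜, F) n f ((chartAt E p).symm z)) :
    ContDiffAt 𝕜 n (fun y => f ((chartAt E p).symm y)) z :=
  contMDiffAt_iff_contDiffAt.1 <| hf.comp z <|
    (contMDiffOn_chart_symm (I := 𝓘(𝕜, E)) (n := n) (x := p)).contMDiffAt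
      ((chartAt E p).open_target.mem_nhds hz)

variable {X : Type u} [TopologicalSpace X] [ChartedSpace ℂ X]

theorem analyticAt_transition [IsManifold 𝓘(ℂ, ℂ) ω X] {p q : X} {z : ℂ}
    (hz : z ∈ (chartAt ℂ p).target) (hq : (chartAt ℂ p).symm z ∈ (chartAt ℂ q).source) :
    AnalyticAt ℂ (fun y => chartAt ℂ q ((chartAt ℂ p).symm y)) z :=
  ContDiffAt.analyticAt <| contDiffAt_comp_chartAt_symm (n := ω) hz <|
    (contMDiffOn_chart (I := 𝓘(ℂ, ℂ)) (n := ω) (x := q)).contMDiffAt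
      ((chartAt ℂ q).open_source.mem_nhds hq)

/-- A Riemann surface is a smooth real surface. -/
theorem isManifold_real_of_complex [IsManifold 𝓘(ℂ, ℂ) ω X] : IsManifold 𝓘(ℝ, ℂ) ∞ X := by
  refine isManifold_of_contDiffOn 𝓘(ℝ, ℂ) ∞ X fun e e' he he' => ?_
  have h := StructureGroupoid.compatible (contDiffGroupoid ω 𝓘(ℂ, ℂ)) he he'
  have h' := contMDiffOn_iff_contDiffOn.1 (contMDiffOn_of_mem_contDiffGroupoid h)
  have h'' : ContDiffOn ℝ ∞ (e.symm ≫ₕ e') (e.symm ≫ₕ e').source :=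
    (h'.restrict_scalars ℝ).of_le le_top
  simpa using h''

/-- A real function on `X` which is `C²` in all charts. -/
def IsChartC2 (f : X → ℝ) : Prop :=
  ∀ p : X, ∀ z ∈ (chartAt ℂ p).target, ContDiffAt ℝ 2 (fun y => f ((chartAt ℂ p).symm y)) z

theorem continuousAt_laplacian {f : ℂ → ℝ} {z : ℂ} (hf : ContDiffAt ℝ 2 f z) :
    ContinuousAt (Laplacian.laplacian f) z := by
  have h1 : ContDiffAt ℝ 0 (fderiv ℝ (fderiv ℝ f)) z :=
    (hf.fderiv_right (m := 1) (by norm_num)).fderiv_right (m := 0) (by norm_num)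
  have h2 := h1.continuousAt
  rw [funext (laplacian_eq_fderiv_fderiv f)]
  fun_prop

/-- The real determinant of multiplication by `a` is the norm of `a` for `ℂ / ℝ`; it is the Jacobian
in changes of charts. -/
theorem det_mul_real (a : ℂ) :
    (((1 : ℂ →L[ℂ] ℂ).smulRight a).restrictScalars ℝ).det = ‖a‖ ^ 2 := by
  rw [← Complex.normSq_eq_norm_sq, ← Algebra.norm_complex_apply, Algebra.norm_apply]
  unfold ContinuousLinearMap.det
  congr 1
  ext <;> simp [mul_comm]

/-- Change of coordinates in integrals over charts. -/
theorem setIntegral_chartAt_eq [IsManifold 𝓘(ℂ, ℂ) ω X] {p q : X} {f g : ℂ → ℝ}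
    (hfg : ∀ z ∈ (chartAt ℂ p).target, (chartAt ℂ p).symm z ∈ (chartAt ℂ q).source →
      f z = ‖deriv (fun y => chartAt ℂ q ((chartAt ℂ p).symm y)) z‖ ^ 2 *
        g (chartAt ℂ q ((chartAt ℂ p).symm z)))
    (hf : ∀ z ∈ (chartAt ℂ p).target, (chartAt ℂ p).symm z ∉ (chartAt ℂ q).source → f z = 0)
    (hg : ∀ z ∈ (chartAt ℂ q).target, (chartAt ℂ q).symm z ∉ (chartAt ℂ p).source → g z = 0) :
    ∫ z in (chartAt ℂ p).target, f z = ∫ z in (chartAt ℂ q).target, g z := by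
  set e := (chartAt ℂ p).symm ≫ₕ (chartAt ℂ q) with he
  have hs : e.source = (chartAt ℂ p).target ∩ (chartAt ℂ p).symm ⁻¹' (chartAt ℂ q).source := by
    simp [he]
  have ht : e.target = (chartAt ℂ q).target ∩ (chartAt ℂ q).symm ⁻¹' (chartAt ℂ p).source := by
    simp [he]
  have h1 : ∫ z in (chartAt ℂ p).target, f z = ∫ z in e.source, f z := by
    refine setIntegral_eq_of_subset_of_forall_sdiff_eq_zero
      (chartAt ℂ p).open_target.measurableSet (by rw [hs]; exact Set.inter_subset_left) ?_
    rintro z ⟨hz, hz'⟩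
    exact hf z hz fun h => hz' (by rw [hs]; exact ⟨hz, h⟩)
  have h2 : ∫ z in (chartAt ℂ q).target, g z = ∫ z in e.target, g z := by
    refine setIntegral_eq_of_subset_of_forall_sdiff_eq_zero
      (chartAt ℂ q).open_target.measurableSet (by rw [ht]; exact Set.inter_subset_left) ?_
    rintro z ⟨hz, hz'⟩
    exact hg z hz fun h => hz' (by rw [ht]; exact ⟨hz, h⟩)
  rw [h1, h2, ← e.image_source_eq_target,
    integral_image_eq_integral_abs_det_fderiv_smul volume e.open_source.measurableSet
      (f' := fun z => ((1 : ℂ →L[ℂ] ℂ).smulRight (deriv e z)).restrictScalars ℝ) ?_ e.injOn]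
  · refine setIntegral_congr_fun e.open_source.measurableSet fun z hz => ?_
    have hz' := hz
    rw [hs] at hz'
    simp only [det_mul_real, abs_of_nonneg (sq_nonneg ‖deriv e z‖), smul_eq_mul]
    exact hfg z hz'.1 hz'.2
  · intro z hz
    rw [hs] at hz
    have := (analyticAt_transition hz.1 hz.2).differentiableAt.hasDerivAt.hasFDerivAt
    exact (this.restrictScalars ℝ).hasFDerivWithinAt

/-- Continuity on the open target alone gives no control at its boundary; here `f` lives on the
compact image of `A`, where it is bounded. -/
theorem integrableOn_chartAt_target [T2Space X] {p : X} {f : ℂ → ℝ} {A : Set X}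
    (hA : IsCompact A) (hAp : A ⊆ (chartAt ℂ p).source)
    (hf : ContinuousOn f (chartAt ℂ p).target)
    (hfA : ∀ z ∈ (chartAt ℂ p).target, (chartAt ℂ p).symm z ∉ A → f z = 0) :
    IntegrableOn f (chartAt ℂ p).target := by
  have hC : IsCompact (chartAt ℂ p '' A) :=
    hA.image_of_continuousOn ((chartAt ℂ p).continuousOn.mono hAp)
  have hCt : chartAt ℂ p '' A ⊆ (chartAt ℂ p).target := by
    rintro _ ⟨x, hx, rfl⟩
    exact (chartAt ℂ p).map_source (hAp hx)
  refine IntegrableOn.of_forall_sdiff_eq_zero ((hf.mono hCt).integrableOn_compact hC)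
    (chartAt ℂ p).open_target.measurableSet ?_
  rintro z ⟨hz, hz'⟩
  exact hfA z hz fun h => hz' ⟨_, h, (chartAt ℂ p).right_inv hz⟩

/-- The integral over `X` of the `2`-form with coefficient `K p` in the chart around `p`,
computed with the partition of unity `ρ`. -/
noncomputable def chartIntegral (ρ : SmoothPartitionOfUnity X 𝓘(ℝ, ℂ) X Set.univ)
    (K : X → ℂ → ℝ) : ℝ :=
  ∑ᶠ p : X, ∫ z in (chartAt ℂ p).target, ρ p ((chartAt ℂ p).symm z) * K p z

/-- The functions `K p` are the coefficients in the charts of a `2`-form on `X`. -/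
def IsTwoForm (K : X → ℂ → ℝ) : Prop :=
  ∀ p q : X, ∀ z ∈ (chartAt ℂ p).target, (chartAt ℂ p).symm z ∈ (chartAt ℂ q).source →
    K p z = ‖deriv (fun y => chartAt ℂ q ((chartAt ℂ p).symm y)) z‖ ^ 2 *
      K q (chartAt ℂ q ((chartAt ℂ p).symm z))

theorem continuousOn_comp_chartAt_symm {f : X → ℝ} (hf : Continuous f) (p : X) :
    ContinuousOn (fun z => f ((chartAt ℂ p).symm z)) (chartAt ℂ p).target :=
  hf.comp_continuousOn (chartAt ℂ p).continuousOn_symm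

theorem continuous_partition (ρ : SmoothPartitionOfUnity X 𝓘(ℝ, ℂ) X Set.univ) (p : X) :
    Continuous (ρ p) := (ρ p).contMDiff.continuous

theorem chartIntegral_congr {ρ : SmoothPartitionOfUnity X 𝓘(ℝ, ℂ) X Set.univ} {K K' : X → ℂ → ℝ}
    (h : ∀ p : X, ∀ z ∈ (chartAt ℂ p).target, K p z = K' p z) :
    chartIntegral ρ K = chartIntegral ρ K' := by
  unfold chartIntegral
  refine finsum_congr fun p => setIntegral_congr_fun (chartAt ℂ p).open_target.measurableSet
    fun z hz => ?_
  simp only [h p z hz]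

/-- Conformal invariance for a transition map. The factor is the one by which `dx ∧ dy` changes,
which is why Laplacians in charts are coefficients of a 2-form. -/
theorem laplacian_chart_change [IsManifold 𝓘(ℂ, ℂ) ω X] {f : X → ℝ} {p q : X} {z : ℂ}
    (hz : z ∈ (chartAt ℂ p).target) (hq : (chartAt ℂ p).symm z ∈ (chartAt ℂ q).source)
    (hf : ContDiffAt ℝ 2 (fun y => f ((chartAt ℂ q).symm y))
      (chartAt ℂ q ((chartAt ℂ p).symm z))) :
    Laplacian.laplacian (fun y => f ((chartAt ℂ p).symm y)) z =
      ‖deriv (fun y => chartAt ℂ q ((chartAt ℂ p).symm y)) z‖ ^ 2 *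
        Laplacian.laplacian (fun y => f ((chartAt ℂ q).symm y))
          (chartAt ℂ q ((chartAt ℂ p).symm z)) := by
  rw [← laplacian_comp_analytic hf (analyticAt_transition hz hq)]
  apply (InnerProductSpace.laplacian_congr_nhds _).eq_of_nhds
  have : ∀ᶠ y in 𝓝 z, (chartAt ℂ p).symm y ∈ (chartAt ℂ q).source :=
    ((chartAt ℂ p).continuousAt_symm hz).eventually ((chartAt ℂ q).open_source.mem_nhds hq)
  filter_upwards [this] with y hy
  rw [(chartAt ℂ q).left_inv hy]

theorem isTwoForm_laplacian [IsManifold 𝓘(ℂ, ℂ) ω X] {f : X → ℝ} (hf : IsChartC2 f) :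
    IsTwoForm fun p => Laplacian.laplacian fun z => f ((chartAt ℂ p).symm z) :=
  fun _ q _ hz hq => laplacian_chart_change hz hq (hf q _ ((chartAt ℂ q).map_source hq))

theorem continuousOn_laplacian_chart {f : X → ℝ} (hf : IsChartC2 f) (p : X) :
    ContinuousOn (Laplacian.laplacian fun z => f ((chartAt ℂ p).symm z)) (chartAt ℂ p).target :=
  fun z hz => (continuousAt_laplacian (hf p z hz)).continuousWithinAt

section Compact

variable [CompactSpace X]

theorem finite_support_partition (ρ : SmoothPartitionOfUnity X 𝓘(ℝ, ℂ) X Set.univ) :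
    {p | (Function.support (ρ p)).Nonempty}.Finite :=
  ρ.locallyFinite.finite_nonempty_of_compact

/-- The indices of the non-zero functions of a partition of unity of a compact surface. -/
noncomputable def partitionIndices (ρ : SmoothPartitionOfUnity X 𝓘(ℝ, ℂ) X Set.univ) : Finset X :=
  (finite_support_partition ρ).toFinset

theorem partition_apply_eq_zero {ρ : SmoothPartitionOfUnity X 𝓘(ℝ, ℂ) X Set.univ} {p : X}
    (hp : p ∉ partitionIndices ρ) (x : X) : ρ p x = 0 := by
  by_contra h
  exact hp ((finite_support_partition ρ).mem_toFinset.2 ⟨x, h⟩)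

theorem sum_partition (ρ : SmoothPartitionOfUnity X 𝓘(ℝ, ℂ) X Set.univ) (x : X) :
    ∑ p ∈ partitionIndices ρ, ρ p x = 1 := by
  rw [← ρ.sum_eq_one (Set.mem_univ x)]
  refine (finsum_eq_sum_of_support_subset _ fun p hp => ?_).symm
  by_contra h
  exact hp (partition_apply_eq_zero h x)

theorem chartIntegral_eq_sum (ρ : SmoothPartitionOfUnity X 𝓘(ℝ, ℂ) X Set.univ) (K : X → ℂ → ℝ) :
    chartIntegral ρ K = ∑ p ∈ partitionIndices ρ,
      ∫ z in (chartAt ℂ p).target, ρ p ((chartAt ℂ p).symm z) * K p z := by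
  refine finsum_eq_sum_of_support_subset _ fun p hp => ?_
  by_contra h
  refine hp ?_
  simp [partition_apply_eq_zero h]

theorem integrableOn_partition_mul [T2Space X] {ρ : SmoothPartitionOfUnity X 𝓘(ℝ, ℂ) X Set.univ}
    (hρ : ρ.IsSubordinate (fun p => (chartAt ℂ p).source)) {p : X} {f : ℂ → ℝ}
    (hf : ContinuousOn f (chartAt ℂ p).target) :
    IntegrableOn (fun z => ρ p ((chartAt ℂ p).symm z) * f z) (chartAt ℂ p).target := by
  refine integrableOn_chartAt_target (isClosed_tsupport (ρ p)).isCompact (hρ p)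
    ((continuousOn_comp_chartAt_symm (continuous_partition ρ p) p).mul hf) fun z _ hz => ?_
  rw [image_eq_zero_of_notMem_tsupport hz, zero_mul]

end Compact
end Charts

/-! ### Independence of the partition of unity, and Stokes' theorem. -/

section ChartIntegral

open Filter Topology MeasureTheory Complex

variable {X : Type u} [TopologicalSpace X] [ChartedSpace ℂ X] [CompactSpace X] [T2Space X]
  {ρ : SmoothPartitionOfUnity X 𝓘(ℝ, ℂ) X Set.univ}

theorem chartIntegral_add (hρ : ρ.IsSubordinate (fun p => (chartAt ℂ p).source))
    {K K' : X → ℂ → ℝ} (hK : ∀ p : X, ContinuousOn (K p) (chartAt ℂ p).target)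
    (hK' : ∀ p : X, ContinuousOn (K' p) (chartAt ℂ p).target) :
    chartIntegral ρ (fun p z => K p z + K' p z) = chartIntegral ρ K + chartIntegral ρ K' := by
  simp only [chartIntegral_eq_sum]
  rw [← Finset.sum_add_distrib]
  refine Finset.sum_congr rfl fun p _ => ?_
  rw [← integral_add (integrableOn_partition_mul hρ (hK p)) (integrableOn_partition_mul hρ (hK' p))]
  simp only [mul_add]

theorem chartIntegral_const_mul (c : ℝ) (K : X → ℂ → ℝ) :
    chartIntegral ρ (fun p z => c * K p z) = c * chartIntegral ρ K := by
  simp only [chartIntegral_eq_sum]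
  rw [Finset.mul_sum]
  refine Finset.sum_congr rfl fun p _ => ?_
  rw [← integral_const_mul]
  congr 1
  funext z
  ring

theorem chartIntegral_add_const_mul (hρ : ρ.IsSubordinate (fun p => (chartAt ℂ p).source))
    {K K' : X → ℂ → ℝ} (c : ℝ) (hK : ∀ p : X, ContinuousOn (K p) (chartAt ℂ p).target)
    (hK' : ∀ p : X, ContinuousOn (K' p) (chartAt ℂ p).target) :
    chartIntegral ρ (fun p z => K p z + c * K' p z) =
      chartIntegral ρ K + c * chartIntegral ρ K' := by
  rw [chartIntegral_add hρ hK (K' := fun p z => c * K' p z)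
    fun p => continuousOn_const.mul (hK' p), chartIntegral_const_mul]

theorem chartIntegral_mono (hρ : ρ.IsSubordinate (fun p => (chartAt ℂ p).source))
    {K K' : X → ℂ → ℝ} (hK : ∀ p : X, ContinuousOn (K p) (chartAt ℂ p).target)
    (hK' : ∀ p : X, ContinuousOn (K' p) (chartAt ℂ p).target)
    (h : ∀ p : X, ∀ᵐ z ∂volume.restrict (chartAt ℂ p).target, K p z ≤ K' p z) :
    chartIntegral ρ K ≤ chartIntegral ρ K' := by
  simp only [chartIntegral_eq_sum]
  refine Finset.sum_le_sum fun p _ => ?_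
  refine integral_mono_ae (integrableOn_partition_mul hρ (hK p))
    (integrableOn_partition_mul hρ (hK' p)) ?_
  filter_upwards [h p] with z hz
  exact mul_le_mul_of_nonneg_left hz (ρ.nonneg p _)

/-- The integral of a `2`-form does not depend on the partition of unity. -/
theorem chartIntegral_eq_of_isTwoForm [IsManifold 𝓘(ℂ, ℂ) ω X]
    {ρ' : SmoothPartitionOfUnity X 𝓘(ℝ, ℂ) X Set.univ}
    (hρ : ρ.IsSubordinate (fun p => (chartAt ℂ p).source))
    (hρ' : ρ'.IsSubordinate (fun p => (chartAt ℂ p).source))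
    {K : X → ℂ → ℝ} (hK : ∀ p : X, ContinuousOn (K p) (chartAt ℂ p).target)
    (hform : IsTwoForm K) : chartIntegral ρ K = chartIntegral ρ' K := by
  -- Inserting `∑ τ q = 1` gives a double sum over `σ p` and `τ q`. Each term can be moved from the
  -- chart of `p` to that of `q`, which makes the expression symmetric in the two partitions.
  have expand : ∀ {σ τ : SmoothPartitionOfUnity X 𝓘(ℝ, ℂ) X Set.univ},
      σ.IsSubordinate (fun p => (chartAt ℂ p).source) →
      chartIntegral σ K = ∑ p ∈ partitionIndices σ, ∑ q ∈ partitionIndices τ,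
        ∫ z in (chartAt ℂ p).target, τ q ((chartAt ℂ p).symm z) *
          (σ p ((chartAt ℂ p).symm z) * K p z) := by
    intro σ τ hσ
    rw [chartIntegral_eq_sum]
    refine Finset.sum_congr rfl fun p _ => ?_
    rw [← integral_finsetSum]
    · refine integral_congr_ae (Eventually.of_forall fun z => ?_)
      simp only
      rw [← Finset.sum_mul, sum_partition, one_mul]
    · intro q _
      have := integrableOn_partition_mul hσ
        ((continuousOn_comp_chartAt_symm (continuous_partition τ q) p).mul (hK p))
      refine this.congr (Eventually.of_forall fun z => ?_)
      simp only [Pi.mul_apply]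
      ring
  rw [expand (τ := ρ') hρ, expand (τ := ρ) hρ', Finset.sum_comm]
  refine Finset.sum_congr rfl fun q _ => Finset.sum_congr rfl fun p _ => ?_
  have hzero : ∀ {σ : SmoothPartitionOfUnity X 𝓘(ℝ, ℂ) X Set.univ},
      σ.IsSubordinate (fun p => (chartAt ℂ p).source) → ∀ {p x : X},
      x ∉ (chartAt ℂ p).source → σ p x = 0 := by
    intro σ hσ p x hx
    exact image_eq_zero_of_notMem_tsupport fun h => hx (hσ p h)
  refine setIntegral_chartAt_eq (fun z hz hz' => ?_) (fun z hz hz' => ?_) (fun z hz hz' => ?_)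
  · rw [hform p q z hz hz', (chartAt ℂ q).left_inv hz']
    ring
  · rw [hzero hρ' hz', zero_mul]
  · rw [hzero hρ hz', zero_mul]

/-- Read in the chart around `q`, the function extends by zero to a compactly supported `C²`
function on the plane. -/
theorem setIntegral_laplacian_eq_zero {f : X → ℝ} (hf : IsChartC2 f) {q : X}
    (hfq : tsupport f ⊆ (chartAt ℂ q).source) :
    ∫ z in (chartAt ℂ q).target, Laplacian.laplacian (fun y => f ((chartAt ℂ q).symm y)) z = 0 := by
  set F : ℂ → ℝ := (chartAt ℂ q).target.indicator fun y => f ((chartAt ℂ q).symm y) with hF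
  have hC : IsCompact (chartAt ℂ q '' tsupport f) :=
    (isClosed_tsupport f).isCompact.image_of_continuousOn ((chartAt ℂ q).continuousOn.mono hfq)
  have hF0 : ∀ z ∉ chartAt ℂ q '' tsupport f, F z = 0 := by
    intro z hz
    by_cases hzt : z ∈ (chartAt ℂ q).target
    · rw [hF, Set.indicator_of_mem hzt]
      exact image_eq_zero_of_notMem_tsupport fun h => hz ⟨_, h, (chartAt ℂ q).right_inv hzt⟩
    · exact Set.indicator_of_notMem hzt _
  have hFt : ∀ z ∈ (chartAt ℂ q).target, F =ᶠ[𝓝 z] fun y => f ((chartAt ℂ q).symm y) := by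
    intro z hz
    filter_upwards [(chartAt ℂ q).open_target.mem_nhds hz] with y hy
    exact Set.indicator_of_mem hy _
  have hFc : ∀ z ∉ chartAt ℂ q '' tsupport f, F =ᶠ[𝓝 z] fun _ => 0 := by
    intro z hz
    filter_upwards [hC.isClosed.isOpen_compl.mem_nhds hz] with y hy
    exact hF0 y hy
  have hcd : ContDiff ℝ 2 F := by
    rw [contDiff_iff_contDiffAt]
    intro z
    by_cases hz : z ∈ chartAt ℂ q '' tsupport f
    · obtain ⟨x, hx, rfl⟩ := hz
      have hz := (chartAt ℂ q).map_source (hfq hx)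
      exact (hf q _ hz).congr_of_eventuallyEq (hFt _ hz)
    · exact contDiffAt_const.congr_of_eventuallyEq (hFc z hz)
  have h1 : ∫ z in (chartAt ℂ q).target, Laplacian.laplacian (fun y => f ((chartAt ℂ q).symm y)) z
      = ∫ z in (chartAt ℂ q).target, Laplacian.laplacian F z := by
    refine setIntegral_congr_fun (chartAt ℂ q).open_target.measurableSet fun z hz => ?_
    exact (InnerProductSpace.laplacian_congr_nhds (hFt z hz)).eq_of_nhds.symm
  rw [h1, setIntegral_eq_integral_of_forall_compl_eq_zero,
    integral_laplacian_eq_zero hcd (HasCompactSupport.intro hC hF0)]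
  intro z hz
  have : z ∉ chartAt ℂ q '' tsupport f := by
    rintro ⟨x, hx, rfl⟩
    exact hz ((chartAt ℂ q).map_source (hfq hx))
  rw [(InnerProductSpace.laplacian_congr_nhds (hFc z this)).eq_of_nhds]
  simp

theorem isChartC2_partition [IsManifold 𝓘(ℂ, ℂ) ω X] (p : X) : IsChartC2 (ρ p) := by
  have : IsManifold 𝓘(ℝ, ℂ) ∞ X := isManifold_real_of_complex
  intro q z hz
  have h := contDiffAt_comp_chartAt_symm hz ((ρ p).contMDiff.contMDiffAt)
  exact h.of_le (WithTop.coe_le_coe.2 (le_top : (2 : ℕ∞) ≤ ⊤))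

/-- All terms can be moved to the single chart around `q`, where the functions `ρ p` sum to `1` and
the plane case applies. -/
theorem chartIntegral_laplacian_eq_zero_of_tsupport [IsManifold 𝓘(ℂ, ℂ) ω X]
    (hρ : ρ.IsSubordinate (fun p => (chartAt ℂ p).source)) {f : X → ℝ} (hf : IsChartC2 f) {q : X}
    (hfq : tsupport f ⊆ (chartAt ℂ q).source) :
    chartIntegral ρ (fun p => Laplacian.laplacian fun z => f ((chartAt ℂ p).symm z)) = 0 := by
  rw [chartIntegral_eq_sum]
  have hzero : ∀ p : X, ∀ z ∈ (chartAt ℂ p).target,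
      (chartAt ℂ p).symm z ∉ (chartAt ℂ q).source →
      Laplacian.laplacian (fun y => f ((chartAt ℂ p).symm y)) z = 0 := by
    intro p z hz hzq
    have h1 : ∀ᶠ y in 𝓝 z, (chartAt ℂ p).symm y ∈ (tsupport f)ᶜ :=
      ((chartAt ℂ p).continuousAt_symm hz).eventually
        ((isClosed_tsupport f).isOpen_compl.mem_nhds fun h => hzq (hfq h))
    have h2 : (fun y => f ((chartAt ℂ p).symm y)) =ᶠ[𝓝 z] fun _ => 0 := by
      filter_upwards [h1] with y hy
      exact image_eq_zero_of_notMem_tsupport hy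
    rw [(InnerProductSpace.laplacian_congr_nhds h2).eq_of_nhds]
    simp
  have hmove : ∀ p : X, ∫ z in (chartAt ℂ p).target, ρ p ((chartAt ℂ p).symm z) *
      Laplacian.laplacian (fun y => f ((chartAt ℂ p).symm y)) z =
      ∫ z in (chartAt ℂ q).target, ρ p ((chartAt ℂ q).symm z) *
        Laplacian.laplacian (fun y => f ((chartAt ℂ q).symm y)) z := by
    intro p
    refine setIntegral_chartAt_eq (fun z hz hz' => ?_) (fun z hz hz' => ?_) (fun z hz hz' => ?_)
    · have h1 := isTwoForm_laplacian hf p q z hz hz'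
      simp only at h1
      rw [h1, (chartAt ℂ q).left_inv hz']
      ring
    · rw [hzero p z hz hz', mul_zero]
    · rw [image_eq_zero_of_notMem_tsupport fun h => hz' (hρ p h), zero_mul]
  rw [Finset.sum_congr rfl fun p _ => hmove p, ← integral_finsetSum]
  · simp only [← Finset.sum_mul, sum_partition, one_mul]
    exact setIntegral_laplacian_eq_zero hf hfq
  · intro p _
    refine integrableOn_chartAt_target (A := tsupport f) (isClosed_tsupport f).isCompact hfq
      ((continuousOn_comp_chartAt_symm (continuous_partition ρ p) q).mul
        (continuousOn_laplacian_chart hf q)) fun z hz hz' => ?_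
    have h1 : ∀ᶠ y in 𝓝 z, (chartAt ℂ q).symm y ∈ (tsupport f)ᶜ :=
      ((chartAt ℂ q).continuousAt_symm hz).eventually
        ((isClosed_tsupport f).isOpen_compl.mem_nhds hz')
    have h2 : (fun y => f ((chartAt ℂ q).symm y)) =ᶠ[𝓝 z] fun _ => 0 := by
      filter_upwards [h1] with y hy
      exact image_eq_zero_of_notMem_tsupport hy
    rw [(InnerProductSpace.laplacian_congr_nhds h2).eq_of_nhds]
    simp

theorem chartIntegral_sum (hρ : ρ.IsSubordinate (fun p => (chartAt ℂ p).source))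
    {ι : Type*} (s : Finset ι) {K : ι → X → ℂ → ℝ}
    (hK : ∀ i, ∀ p : X, ContinuousOn (K i p) (chartAt ℂ p).target) :
    chartIntegral ρ (fun p z => ∑ i ∈ s, K i p z) = ∑ i ∈ s, chartIntegral ρ (K i) := by
  classical
  induction s using Finset.induction_on with
  | empty => simp [chartIntegral]
  | insert a s ha ih =>
    simp only [Finset.sum_insert ha]
    rw [chartIntegral_add hρ (hK a), ih]
    exact fun p => continuousOn_finsetSum _ fun i _ => hK i p

theorem laplacian_finsetSum {ι : Type*} (s : Finset ι) {f : ι → ℂ → ℝ} {z : ℂ}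
    (hf : ∀ i, ContDiffAt ℝ 2 (f i) z) :
    Laplacian.laplacian (fun y => ∑ i ∈ s, f i y) z = ∑ i ∈ s, Laplacian.laplacian (f i) z := by
  classical
  induction s using Finset.induction_on with
  | empty => simp
  | insert a s ha ih =>
    simp only [Finset.sum_insert ha]
    rw [← ih]
    exact (hf a).laplacian_add (f₂ := fun y => ∑ i ∈ s, f i y) (ContDiffAt.sum fun i _ => hf i)

/-- Stokes: the integral over `X` of `Δ f` vanishes. -/
theorem chartIntegral_laplacian_eq_zero [IsManifold 𝓘(ℂ, ℂ) ω X]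
    (hρ : ρ.IsSubordinate (fun p => (chartAt ℂ p).source)) {f : X → ℝ} (hf : IsChartC2 f) :
    chartIntegral ρ (fun p => Laplacian.laplacian fun z => f ((chartAt ℂ p).symm z)) = 0 := by
  -- The function is cut into the pieces `ρ q * f`, each supported in one chart.
  have hq : ∀ q : X, IsChartC2 fun x => ρ q x * f x := fun q p z hz =>
    (isChartC2_partition (ρ := ρ) q p z hz).mul (hf p z hz)
  have h1 : chartIntegral ρ (fun p => Laplacian.laplacian fun z => f ((chartAt ℂ p).symm z)) =
      chartIntegral ρ fun p z => ∑ q ∈ partitionIndices ρ,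
        Laplacian.laplacian (fun z => ρ q ((chartAt ℂ p).symm z) * f ((chartAt ℂ p).symm z)) z := by
    refine chartIntegral_congr fun p z hz => ?_
    have h2 := laplacian_finsetSum (partitionIndices ρ)
      (f := fun q y => ρ q ((chartAt ℂ p).symm y) * f ((chartAt ℂ p).symm y))
      fun q => hq q p z hz
    rw [← h2]
    simp only [← Finset.sum_mul, sum_partition, one_mul]
  have h2 : ∀ q : X, chartIntegral ρ (fun p => Laplacian.laplacian fun z =>
      ρ q ((chartAt ℂ p).symm z) * f ((chartAt ℂ p).symm z)) = 0 := fun q =>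
    chartIntegral_laplacian_eq_zero_of_tsupport hρ (f := fun x => ρ q x * f x) (hq q) (q := q)
      ((tsupport_mul_subset_left (f := ρ q) (g := f)).trans (hρ q))
  have h3 := chartIntegral_sum hρ (partitionIndices ρ) (K := fun q p =>
    Laplacian.laplacian fun z => ρ q ((chartAt ℂ p).symm z) * f ((chartAt ℂ p).symm z))
    fun q p => continuousOn_laplacian_chart (hq q) p
  rw [h1, h3]
  exact Finset.sum_eq_zero fun q _ => h2 q

end ChartIntegral

/-! ### Sign of the curvature integral for metrics with singularities `|G|²`. -/

section SingularMetric

open Filter Topology MeasureTheory Complex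

variable {X : Type u} [TopologicalSpace X] [ChartedSpace ℂ X]

/-- In the charts, `Φ` is locally of the form `|G|² e^w` with `G` holomorphic and non-zero and `w`
of class `C²`, and `Δ w = K`. -/
def IsSingularPotential (Φ : X → ℝ) (K : X → ℂ → ℝ) : Prop :=
  ∀ p : X, ∀ z₀ ∈ (chartAt ℂ p).target, ∃ (G : ℂ → ℂ) (W : ℂ → ℝ),
    AnalyticAt ℂ G z₀ ∧ ContDiffAt ℝ 2 W z₀ ∧ (∀ᶠ z in 𝓝[≠] z₀, G z ≠ 0) ∧
    (∀ᶠ z in 𝓝 z₀, Φ ((chartAt ℂ p).symm z) = ‖G z‖ ^ 2 * Real.exp (W z)) ∧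
    K p =ᶠ[𝓝 z₀] Laplacian.laplacian W

namespace IsSingularPotential

variable {Φ : X → ℝ} {K : X → ℂ → ℝ}

theorem nonneg (h : IsSingularPotential Φ K) (x : X) : 0 ≤ Φ x := by
  obtain ⟨G, W, -, -, -, hΦ, -⟩ := h x (chartAt ℂ x x) (mem_chart_target ℂ x)
  have := hΦ.self_of_nhds
  rw [(chartAt ℂ x).left_inv (mem_chart_source ℂ x)] at this
  rw [this]
  positivity

theorem isChartC2 (h : IsSingularPotential Φ K) : IsChartC2 Φ := by
  intro p z hz
  obtain ⟨G, W, hG, hW, -, hΦ, -⟩ := h p z hz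
  have hG' : ContDiffAt ℝ 2 G z := hG.contDiffAt.restrict_scalars ℝ
  exact ((hG'.norm_sq ℝ).mul hW.exp).congr_of_eventuallyEq hΦ

theorem continuousOn (h : IsSingularPotential Φ K) (p : X) :
    ContinuousOn (K p) (chartAt ℂ p).target := by
  intro z hz
  obtain ⟨G, W, -, hW, -, -, hK⟩ := h p z hz
  exact ((continuousAt_laplacian hW).congr_of_eventuallyEq hK).continuousWithinAt

/-- The zeros of `Φ` are those of the local functions `G`, which are isolated; a locally null set is
null. -/
theorem ae_ne_zero (h : IsSingularPotential Φ K) (p : X) :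
    ∀ᵐ z ∂volume.restrict (chartAt ℂ p).target, Φ ((chartAt ℂ p).symm z) ≠ 0 := by
  rw [ae_restrict_iff' (chartAt ℂ p).open_target.measurableSet]
  have : volume {z | z ∈ (chartAt ℂ p).target ∧ Φ ((chartAt ℂ p).symm z) = 0} = 0 := by
    refine measure_null_of_locally_null _ fun z hz => ⟨{z}, ?_, by simp⟩
    obtain ⟨G, W, -, -, hG, hΦ, -⟩ := h p z hz.1
    rw [mem_nhdsWithin_iff_eventually]
    filter_upwards [eventually_nhdsWithin_iff.1 hG, hΦ] with y hy1 hy2 hy3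
    by_contra hne
    have h1 := hy3.2
    rw [hy2] at h1
    have := hy1 hne
    have : 0 < ‖G y‖ ^ 2 * Real.exp (W y) := by positivity
    exact this.ne' h1
  filter_upwards [measure_eq_zero_iff_ae_notMem.1 this] with z hz hzt hzΦ
  exact hz ⟨hzt, hzΦ⟩

/-- The shift by `ε` makes the logarithm `C²` across the zeros of `Φ` as well, so that Stokes
applies without cutting out discs. -/
theorem isChartC2_log_add (h : IsSingularPotential Φ K) {ε : ℝ} (hε : 0 < ε) :
    IsChartC2 fun x => Real.log (Φ x + ε) := by
  intro p z hz
  refine ((h.isChartC2 p z hz).add contDiffAt_const).log ?_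
  have := h.nonneg ((chartAt ℂ p).symm z)
  positivity

theorem le_laplacian (h : IsSingularPotential Φ K) {ε : ℝ} (hε : 0 < ε) {p : X} {z : ℂ}
    (hz : z ∈ (chartAt ℂ p).target) (hΦz : Φ ((chartAt ℂ p).symm z) ≠ 0) :
    Φ ((chartAt ℂ p).symm z) / (Φ ((chartAt ℂ p).symm z) + ε) * K p z ≤
      Laplacian.laplacian (fun y => Real.log (Φ ((chartAt ℂ p).symm y) + ε)) z := by
  obtain ⟨G, W, hG, hW, -, hΦ, hK⟩ := h p z hz
  rw [hK.eq_of_nhds]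
  refine le_laplacian_log_add (Φ := fun y => Φ ((chartAt ℂ p).symm y)) hε hG ?_ hW hΦ
  intro hG0
  rw [hΦ.self_of_nhds, hG0] at hΦz
  simp at hΦz

variable [CompactSpace X] [T2Space X] [IsManifold 𝓘(ℂ, ℂ) ω X]
  {ρ : SmoothPartitionOfUnity X 𝓘(ℝ, ℂ) X Set.univ}

/-- The curvature of a metric with singularities of the form `|G|²` has non-positive integral of
`Δ w`: a line bundle with a non-zero holomorphic section has non-negative degree. -/
theorem chartIntegral_nonpos (h : IsSingularPotential Φ K)
    (hρ : ρ.IsSubordinate (fun p => (chartAt ℂ p).source)) : chartIntegral ρ K ≤ 0 := by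
  have hΦc : ∀ p : X, ContinuousOn (fun z => Φ ((chartAt ℂ p).symm z)) (chartAt ℂ p).target :=
    fun p z hz => (h.isChartC2 p z hz).continuousAt.continuousWithinAt
  have hcont : ∀ ε : ℝ, 0 < ε → ∀ p : X, ContinuousOn (fun z => Φ ((chartAt ℂ p).symm z) /
      (Φ ((chartAt ℂ p).symm z) + ε) * K p z) (chartAt ℂ p).target := by
    intro ε hε p
    refine ((hΦc p).div ((hΦc p).add continuousOn_const) fun z _ => ?_).mul (h.continuousOn p)
    exact (add_pos_of_nonneg_of_pos (h.nonneg ((chartAt ℂ p).symm z)) hε).ne'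
  -- Almost everywhere the integrand is at most `Δ log (Φ + ε)`, whose integral is zero by Stokes.
  have hle : ∀ ε : ℝ, 0 < ε → chartIntegral ρ (fun p z => Φ ((chartAt ℂ p).symm z) /
      (Φ ((chartAt ℂ p).symm z) + ε) * K p z) ≤ 0 := by
    intro ε hε
    have hC := h.isChartC2_log_add hε
    rw [← chartIntegral_laplacian_eq_zero (f := fun x => Real.log (Φ x + ε)) hρ hC]
    refine chartIntegral_mono hρ (hcont ε hε)
      (fun p => continuousOn_laplacian_chart (f := fun x => Real.log (Φ x + ε)) hC p) fun p => ?_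
    filter_upwards [h.ae_ne_zero p, ae_restrict_mem (chartAt ℂ p).open_target.measurableSet]
      with z hz hzt
    exact h.le_laplacian hε hzt hz
  have hε : ∀ n : ℕ, (0 : ℝ) < 1 / ((n : ℝ) + 1) := fun n => by positivity
  refine le_of_tendsto' (f := fun n : ℕ => chartIntegral ρ (fun p z => Φ ((chartAt ℂ p).symm z) /
      (Φ ((chartAt ℂ p).symm z) + 1 / ((n : ℝ) + 1)) * K p z)) (x := atTop) ?_
      fun n => hle _ (hε n)
  simp only [chartIntegral_eq_sum]
  refine tendsto_finsetSum _ fun p _ => ?_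
  -- The quotients `Φ / (Φ + ε)` lie in `[0, 1]` and tend to `1` wherever `Φ ≠ 0`, hence almost
  -- everywhere.
  refine tendsto_integral_of_dominated_convergence
    (fun z => ‖ρ p ((chartAt ℂ p).symm z) * K p z‖)
    (fun n => (integrableOn_partition_mul hρ (hcont _ (hε n) p)).aestronglyMeasurable)
    (integrableOn_partition_mul hρ (h.continuousOn p)).norm (fun n => ?_) ?_
  · refine Eventually.of_forall fun z => ?_
    rw [norm_mul, norm_mul, norm_mul]
    have h0 := h.nonneg ((chartAt ℂ p).symm z)
    have h1 : ‖Φ ((chartAt ℂ p).symm z) / (Φ ((chartAt ℂ p).symm z) + 1 / ((n : ℝ) + 1))‖ ≤ 1 := by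
      rw [Real.norm_of_nonneg (by have := hε n; positivity)]
      exact div_le_one_of_le₀ (by linarith [hε n]) (by linarith [hε n])
    exact mul_le_mul_of_nonneg_left (mul_le_of_le_one_left (norm_nonneg _) h1) (norm_nonneg _)
  · filter_upwards [h.ae_ne_zero p] with z hz
    refine Tendsto.const_mul _ ?_
    have h1 : Tendsto (fun n : ℕ => Φ ((chartAt ℂ p).symm z) /
        (Φ ((chartAt ℂ p).symm z) + 1 / ((n : ℝ) + 1))) atTop
        (𝓝 (Φ ((chartAt ℂ p).symm z) / (Φ ((chartAt ℂ p).symm z) + 0))) :=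
      tendsto_const_nhds.div (tendsto_const_nhds.add tendsto_one_div_add_atTop_nhds_zero_nat)
        (by simpa using hz)
    rw [add_zero, div_self hz] at h1
    simpa using h1.mul_const (K p z)

end IsSingularPotential

end SingularMetric

/-! ### Gram determinants and their change under a change of frame. -/

section LinearAlgebra

open Matrix

variable {E : Type*} [AddCommGroup E] [Module ℂ E] {ι : Type*} [Fintype ι] [DecidableEq ι]

/-- The Gram determinant of a family of vectors. -/
noncomputable def gramDeterminant (B : E →ₗ⋆[ℂ] E →ₗ[ℂ] ℂ) (v : ι → E) : ℝ :=
  (Matrix.det (Matrix.of fun i j => B (v i) (v j))).re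

theorem gramDeterminant_reindex (B : E →ₗ⋆[ℂ] E →ₗ[ℂ] ℂ) {κ : Type*} [Fintype κ] [DecidableEq κ]
    (e : κ ≃ ι) (v : ι → E) : gramDeterminant B (fun i => v (e i)) = gramDeterminant B v := by
  unfold gramDeterminant
  rw [← Matrix.det_submatrix_equiv_self e (Matrix.of fun i j => B (v i) (v j))]
  rfl

/-- The Gram matrix changes to `Aᴴ G A`, where `G` is the old one. -/
theorem gramDeterminant_linearCombination (B : E →ₗ⋆[ℂ] E →ₗ[ℂ] ℂ) {v v' : ι → E}
    {A : Matrix ι ι ℂ} (hA : ∀ j, v' j = ∑ i, A i j • v i) :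
    gramDeterminant B v' = ‖A.det‖ ^ 2 * gramDeterminant B v := by
  have h : (Matrix.of fun i j => B (v' i) (v' j)) =
      Aᴴ * (Matrix.of fun i j => B (v i) (v j)) * A := by
    ext i j
    simp only [Matrix.of_apply, Matrix.mul_apply, Matrix.conjTranspose_apply, hA, map_sum,
      map_smul, LinearMap.map_smulₛₗ, LinearMap.sum_apply, LinearMap.smul_apply, smul_eq_mul,
      Finset.sum_mul, Finset.mul_sum, starRingEnd_apply]
    refine Finset.sum_congr rfl fun a _ => Finset.sum_congr rfl fun b _ => ?_
    ring
  have h2 : star A.det * A.det = ((‖A.det‖ ^ 2 : ℝ) : ℂ) := by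
    rw [← Complex.normSq_eq_norm_sq, Complex.normSq_eq_conj_mul_self]
    rfl
  unfold gramDeterminant
  rw [h, Matrix.det_mul, Matrix.det_mul, Matrix.det_conjTranspose, mul_right_comm, h2,
    Complex.re_ofReal_mul]

open scoped ComplexOrder in
theorem gramDeterminant_pos {B : E →ₗ⋆[ℂ] E →ₗ[ℂ] ℂ}
    (hsymm : ∀ a b, starRingEnd ℂ (B a b) = B b a) (hpos : ∀ a, a ≠ 0 → 0 < (B a a).re)
    {v : ι → E} (hv : LinearIndependent ℂ v) : 0 < gramDeterminant B v := by
  have hpd : (Matrix.of fun i j => B (v i) (v j)).PosDef := by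
    refine Matrix.PosDef.of_dotProduct_mulVec_pos ?_ fun c hc => ?_
    · ext i j
      simp only [Matrix.conjTranspose_apply, Matrix.of_apply]
      exact hsymm _ _
    · have h1 : star c ⬝ᵥ (Matrix.of fun i j => B (v i) (v j)) *ᵥ c =
          B (∑ i, c i • v i) (∑ i, c i • v i) := by
        simp only [dotProduct, Matrix.mulVec, Matrix.of_apply, map_sum, map_smul,
          LinearMap.map_smulₛₗ, LinearMap.sum_apply, LinearMap.smul_apply, smul_eq_mul,
          Finset.mul_sum, Pi.star_apply, starRingEnd_apply]
        rw [Finset.sum_comm]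
        refine Finset.sum_congr rfl fun a _ => Finset.sum_congr rfl fun b _ => ?_
        ring
      have h2 : ∑ i, c i • v i ≠ 0 := by
        intro h0
        exact hc (funext (Fintype.linearIndependent_iff.1 hv c h0))
      rw [h1, Complex.lt_def]
      refine ⟨hpos _ h2, ?_⟩
      exact (Complex.conj_eq_iff_im.1 (hsymm _ _)).symm
  exact (Complex.lt_def.1 hpd.det_pos).1

theorem exists_matrix_of_mem_span {v v' : ι → E}
    (h : ∀ j, v' j ∈ Submodule.span ℂ (Set.range v)) :
    ∃ A : Matrix ι ι ℂ, ∀ j, v' j = ∑ i, A i j • v i := by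
  choose A hA using fun j => (Submodule.mem_span_range_iff_exists_fun ℂ).1 (h j)
  exact ⟨fun i j => A j i, fun j => (hA j).symm⟩

/-- The determinant of the images of `v` under a linear map to `ℂ^ι`. -/
noncomputable def coordDet (P : E →ₗ[ℂ] ι → ℂ) (v : ι → E) : ℂ :=
  Matrix.det (Matrix.of fun i j => P (v j) i)

theorem coordDet_linearCombination (P : E →ₗ[ℂ] ι → ℂ) {v v' : ι → E}
    {A : Matrix ι ι ℂ} (hA : ∀ j, v' j = ∑ i, A i j • v i) :
    coordDet P v' = coordDet P v * A.det := by
  unfold coordDet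
  rw [← Matrix.det_mul]
  congr 1
  ext i j
  simp [Matrix.mul_apply, hA, mul_comm]

/-- Both sides change by `|det A|²`. In this form the transition matrix `A` between two frames
disappears: its determinant is a quotient of two coordinate determinants, which are visibly
holomorphic for holomorphic frames, so the holomorphy of `A` itself is never needed. -/
theorem gramDeterminant_mul_coordDet (B : E →ₗ⋆[ℂ] E →ₗ[ℂ] ℂ) (P : E →ₗ[ℂ] ι → ℂ) {v v' : ι → E}
    (h : ∀ j, v' j ∈ Submodule.span ℂ (Set.range v)) :
    gramDeterminant B v' * ‖coordDet P v‖ ^ 2 = gramDeterminant B v * ‖coordDet P v'‖ ^ 2 := by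
  obtain ⟨A, hA⟩ := exists_matrix_of_mem_span h
  rw [gramDeterminant_linearCombination B hA, coordDet_linearCombination P hA, norm_mul]
  ring

/-- `P` is a left inverse of the injection `ℂ^ι → E` given by `v`. It provides a coordinate
determinant that is non-zero at one point and, for a continuous frame, near it. -/
theorem exists_coordDet_eq_one {v : ι → E} (hv : LinearIndependent ℂ v) :
    ∃ P : E →ₗ[ℂ] ι → ℂ, coordDet P v = 1 := by
  obtain ⟨P, hP⟩ := (Fintype.linearCombination ℂ v).exists_leftInverse_of_injective
    (LinearMap.ker_eq_bot.2 (linearIndependent_iff_injective_fintypeLinearCombination.1 hv))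
  refine ⟨P, ?_⟩
  have h : ∀ i, P (v i) = Pi.single i 1 := by
    intro i
    have := LinearMap.congr_fun hP (Pi.single i 1)
    simpa using this
  unfold coordDet
  rw [← Matrix.det_one (n := ι)]
  congr 1
  ext i j
  simp [h, Matrix.one_apply, Pi.single_apply]

end LinearAlgebra

/-! ### Holomorphic sections in local trivializations. -/

namespace HolomorphicVectorBundle

open Filter Topology

variable {X : Type u} [TopologicalSpace X] [ChartedSpace ℂ X] {n : ℕ}

/-- The coordinates on the fibre over `x` in the trivialization around `x₀`. -/
noncomputable def coord (V : HolomorphicVectorBundle.{u, v} X n) (x₀ x : X) :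
    V.Fiber x →ₗ[ℂ] (Fin n → ℂ) :=
  (trivializationAt (Fin n → ℂ) V.Fiber x₀).linearMapAt ℂ x

/-- The domain of the trivialization around `x₀`. -/
def baseSet (V : HolomorphicVectorBundle.{u, v} X n) (x₀ : X) : Set X :=
  (trivializationAt (Fin n → ℂ) V.Fiber x₀).baseSet

theorem isOpen_baseSet (V : HolomorphicVectorBundle.{u, v} X n) (x₀ : X) :
    IsOpen (V.baseSet x₀) := (trivializationAt (Fin n → ℂ) V.Fiber x₀).open_baseSet

theorem mem_baseSet (V : HolomorphicVectorBundle.{u, v} X n) (x₀ : X) : x₀ ∈ V.baseSet x₀ :=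
  FiberBundle.mem_baseSet_trivializationAt' x₀

theorem coord_eq (V : HolomorphicVectorBundle.{u, v} X n) {x₀ x : X} (hx : x ∈ V.baseSet x₀)
    (a : V.Fiber x) : V.coord x₀ x a = (trivializationAt (Fin n → ℂ) V.Fiber x₀ ⟨x, a⟩).2 :=
  congrFun (Trivialization.coe_linearMapAt_of_mem _ hx) a

/-- The vector with given coordinates in the trivialization around `x₀`. -/
noncomputable def vec (V : HolomorphicVectorBundle.{u, v} X n) (x₀ x : X) :
    (Fin n → ℂ) →ₗ[ℂ] V.Fiber x :=
  (trivializationAt (Fin n → ℂ) V.Fiber x₀).symmₗ ℂ x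

theorem coord_vec (V : HolomorphicVectorBundle.{u, v} X n) {x₀ x : X} (hx : x ∈ V.baseSet x₀)
    (c : Fin n → ℂ) : V.coord x₀ x (V.vec x₀ x c) = c :=
  Trivialization.linearMapAt_symmₗ _ hx c

theorem vec_coord (V : HolomorphicVectorBundle.{u, v} X n) {x₀ x : X} (hx : x ∈ V.baseSet x₀)
    (a : V.Fiber x) : V.vec x₀ x (V.coord x₀ x a) = a :=
  Trivialization.symmₗ_linearMapAt _ hx a

theorem coord_injective (V : HolomorphicVectorBundle.{u, v} X n) {x₀ x : X}
    (hx : x ∈ V.baseSet x₀) : Function.Injective (V.coord x₀ x) :=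
  Function.LeftInverse.injective (V.vec_coord hx)

theorem contMDiffAt_coord {V : HolomorphicVectorBundle.{u, v} X n} {x₀ x : X} {U : Set X}
    {s : ∀ x, V.Fiber x} (hU : IsOpen U) (hs : V.IsHolomorphicOn s U) (hxU : x ∈ U)
    (hx : x ∈ V.baseSet x₀) :
    ContMDiffAt 𝓘(ℂ, ℂ) 𝓘(ℂ, Fin n → ℂ) ω (fun y => V.coord x₀ y (s y)) x := by
  have h := (Trivialization.contMDiffAt_section_iff _ hx).1 (hs.contMDiffAt (hU.mem_nhds hxU))
  refine h.congr_of_eventuallyEq ?_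
  filter_upwards [(V.isOpen_baseSet x₀).mem_nhds hx] with y hy
  exact V.coord_eq hy _

theorem isHolomorphicOn_of_coord {V : HolomorphicVectorBundle.{u, v} X n} {x₀ : X} {U : Set X}
    {s : ∀ x, V.Fiber x} (hUx : U ⊆ V.baseSet x₀)
    (hs : ∀ x ∈ U, ContMDiffAt 𝓘(ℂ, ℂ) 𝓘(ℂ, Fin n → ℂ) ω (fun y => V.coord x₀ y (s y)) x) :
    V.IsHolomorphicOn s U := by
  intro x hx
  refine ((Trivialization.contMDiffAt_section_iff
    (trivializationAt (Fin n → ℂ) V.Fiber x₀) (hUx hx)).2 ?_).contMDiffWithinAt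
  refine (hs x hx).congr_of_eventuallyEq ?_
  filter_upwards [(V.isOpen_baseSet x₀).mem_nhds (hUx hx)] with y hy
  exact (V.coord_eq hy _).symm

theorem analyticAt_coord [IsManifold 𝓘(ℂ, ℂ) ω X] {V : HolomorphicVectorBundle.{u, v} X n}
    {x₀ p : X} {z : ℂ} {U : Set X} {s : ∀ x, V.Fiber x} (hU : IsOpen U)
    (hs : V.IsHolomorphicOn s U) (hz : z ∈ (chartAt ℂ p).target)
    (hxU : (chartAt ℂ p).symm z ∈ U) (hx : (chartAt ℂ p).symm z ∈ V.baseSet x₀) :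
    AnalyticAt ℂ (fun y => V.coord x₀ ((chartAt ℂ p).symm y) (s ((chartAt ℂ p).symm y))) z :=
  ContDiffAt.analyticAt
    (contDiffAt_comp_chartAt_symm (f := fun y => V.coord x₀ y (s y)) hz
      (contMDiffAt_coord hU hs hxU hx))

theorem analyticAt_det {ι : Type*} [Fintype ι] [DecidableEq ι] {A : ℂ → Matrix ι ι ℂ} {z : ℂ}
    (hA : ∀ i j, AnalyticAt ℂ (fun y => A y i j) z) : AnalyticAt ℂ (fun y => (A y).det) z := by
  simp only [Matrix.det_apply]
  refine Finset.analyticAt_fun_sum _ fun σ _ => ?_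
  have : AnalyticAt ℂ (fun y => ∏ i, A y (σ i) i) z :=
    Finset.analyticAt_fun_prod _ fun i _ => hA _ _
  simpa only [Units.smul_def, zsmul_eq_mul] using analyticAt_const.fun_mul this

theorem analyticAt_coordDet [IsManifold 𝓘(ℂ, ℂ) ω X] {V : HolomorphicVectorBundle.{u, v} X n}
    {x₀ p : X} {z : ℂ} {U : Set X} {ι : Type*} [Fintype ι] [DecidableEq ι]
    {s : ι → ∀ x, V.Fiber x} (hU : IsOpen U) (P : (Fin n → ℂ) →ₗ[ℂ] ι → ℂ)
    (hs : ∀ i, V.IsHolomorphicOn (s i) U) (hz : z ∈ (chartAt ℂ p).target)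
    (hxU : (chartAt ℂ p).symm z ∈ U) (hx : (chartAt ℂ p).symm z ∈ V.baseSet x₀) :
    AnalyticAt ℂ (fun y => coordDet (P ∘ₗ V.coord x₀ ((chartAt ℂ p).symm y))
      (fun i => s i ((chartAt ℂ p).symm y))) z := by
  unfold coordDet
  refine analyticAt_det fun i j => ?_
  have h1 := analyticAt_coord hU (hs j) hz hxU hx
  have h2 := AnalyticAt.comp (g := P.toContinuousLinearMap) (P.toContinuousLinearMap.analyticAt _) h1
  exact (analyticAt_pi_iff.1 h2) i

theorem contDiffAt_gramDeterminant [IsManifold 𝓘(ℂ, ℂ) ω X]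
    {V : HolomorphicVectorBundle.{u, v} X n} (h : V.HermitianMetric)
    {p : X} {z : ℂ} {U : Set X} {ι : Type*} [Fintype ι] [DecidableEq ι]
    {s : ι → ∀ x, V.Fiber x} (hU : IsOpen U)
    (hs : ∀ i, V.IsHolomorphicOn (s i) U) (hz : z ∈ (chartAt ℂ p).target)
    (hxU : (chartAt ℂ p).symm z ∈ U) :
    ContDiffAt ℝ 2 (fun y => gramDeterminant (h.form ((chartAt ℂ p).symm y))
      (fun i => s i ((chartAt ℂ p).symm y))) z := by
  have : IsManifold 𝓘(ℝ, ℂ) ∞ X := isManifold_real_of_complex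
  have hent : ∀ i j, ContDiffAt ℝ 2 (fun y => h.form ((chartAt ℂ p).symm y)
      (s i ((chartAt ℂ p).symm y)) (s j ((chartAt ℂ p).symm y))) z := fun i j =>
    (contDiffAt_comp_chartAt_symm (f := fun x => h.form x (s i x) (s j x)) hz
      ((h.smooth U (s i) (s j) hU (hs i) (hs j)).contMDiffAt (hU.mem_nhds hxU))).of_le
      (WithTop.coe_le_coe.2 (le_top : (2 : ℕ∞) ≤ ⊤))
  have hdet : ContDiffAt ℝ 2 (fun y => Matrix.det (Matrix.of fun i j =>
      h.form ((chartAt ℂ p).symm y) (s i ((chartAt ℂ p).symm y))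
        (s j ((chartAt ℂ p).symm y)))) z := by
    simp only [Matrix.det_apply]
    refine ContDiffAt.sum fun σ _ => ?_
    have : ContDiffAt ℝ 2 (fun y => ∏ i, h.form ((chartAt ℂ p).symm y)
        (s (σ i) ((chartAt ℂ p).symm y)) (s i ((chartAt ℂ p).symm y))) z :=
      contDiffAt_prod fun i _ => hent _ _
    simpa only [Units.smul_def, zsmul_eq_mul, Matrix.of_apply] using contDiffAt_const.mul this
  exact Complex.reCLM.contDiff.contDiffAt.comp z hdet

end HolomorphicVectorBundle

/-! ### The first Chern form and the degree do not depend on the choices made. -/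

namespace HolomorphicVectorBundle

open Filter Topology

variable {X : Type u} [TopologicalSpace X] [ChartedSpace ℂ X] [IsManifold 𝓘(ℂ, ℂ) ω X] {n : ℕ}
  {V : HolomorphicVectorBundle.{u, v} X n}

theorem gramDeterminant_form_pos (h : V.HermitianMetric) {x : X} {ι : Type*} [Fintype ι]
    [DecidableEq ι] {b : ι → V.Fiber x} (hb : LinearIndependent ℂ b) :
    0 < gramDeterminant (h.form x) b :=
  gramDeterminant_pos (h.conj_symm x) (h.pos x) hb

theorem contDiffAt_log_gramDeterminant (h : V.HermitianMetric) {k : ℕ}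
    {W : ∀ x, Submodule ℂ (V.Fiber x)} {s : Fin k → ∀ x, V.Fiber x} {U : Set X}
    (hs : V.IsHolomorphicFrame W s U) {p : X} {z : ℂ} (hz : z ∈ (chartAt ℂ p).target)
    (hxU : (chartAt ℂ p).symm z ∈ U) :
    ContDiffAt ℝ 2 (fun y => Real.log (gramDeterminant (h.form ((chartAt ℂ p).symm y))
      (fun i => s i ((chartAt ℂ p).symm y)))) z :=
  (contDiffAt_gramDeterminant h hs.isOpen hs.holomorphic hz hxU).log
    (gramDeterminant_form_pos h (hs.linearIndependent _ hxU)).ne'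

/-- The curvature of a metric does not depend on the holomorphic frame. -/
theorem laplacian_log_gramDeterminant_eq (h : V.HermitianMetric) {k : ℕ}
    {W : ∀ x, Submodule ℂ (V.Fiber x)} {s s' : Fin k → ∀ x, V.Fiber x} {U U' : Set X}
    (hs : V.IsHolomorphicFrame W s U) (hs' : V.IsHolomorphicFrame W s' U')
    {p : X} {z : ℂ} (hz : z ∈ (chartAt ℂ p).target)
    (hxU : (chartAt ℂ p).symm z ∈ U) (hxU' : (chartAt ℂ p).symm z ∈ U') :
    Laplacian.laplacian (fun y => Real.log (gramDeterminant (h.form ((chartAt ℂ p).symm y))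
      (fun i => s' i ((chartAt ℂ p).symm y)))) z =
    Laplacian.laplacian (fun y => Real.log (gramDeterminant (h.form ((chartAt ℂ p).symm y))
      (fun i => s i ((chartAt ℂ p).symm y)))) z := by
  set x := (chartAt ℂ p).symm z with hx
  have hind : LinearIndependent ℂ fun i => V.coord x x (s i x) :=
    (hs.linearIndependent x hxU).map' _ (LinearMap.ker_eq_bot.2 (V.coord_injective (V.mem_baseSet x)))
  obtain ⟨P, hP⟩ := exists_coordDet_eq_one hind
  set D : ℂ → ℂ := fun y => coordDet (P ∘ₗ V.coord x ((chartAt ℂ p).symm y))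
      (fun i => s i ((chartAt ℂ p).symm y)) with hD
  set D' : ℂ → ℂ := fun y => coordDet (P ∘ₗ V.coord x ((chartAt ℂ p).symm y))
      (fun i => s' i ((chartAt ℂ p).symm y)) with hD'
  have hDan : AnalyticAt ℂ D z :=
    analyticAt_coordDet hs.isOpen P hs.holomorphic hz hxU (V.mem_baseSet x)
  have hDan' : AnalyticAt ℂ D' z :=
    analyticAt_coordDet hs'.isOpen P hs'.holomorphic hz hxU' (V.mem_baseSet x)
  have hrel : ∀ y, (chartAt ℂ p).symm y ∈ U → (chartAt ℂ p).symm y ∈ U' →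
      gramDeterminant (h.form ((chartAt ℂ p).symm y)) (fun i => s' i ((chartAt ℂ p).symm y)) *
        ‖D y‖ ^ 2 = gramDeterminant (h.form ((chartAt ℂ p).symm y))
          (fun i => s i ((chartAt ℂ p).symm y)) * ‖D' y‖ ^ 2 := by
    intro y hy hy'
    refine gramDeterminant_mul_coordDet _ _ fun j => ?_
    rw [hs.span_eq _ hy, ← hs'.span_eq _ hy']
    exact Submodule.subset_span ⟨j, rfl⟩
  have hDz : D z ≠ 0 := by
    have : D z = 1 := by rw [← hP]; rfl
    rw [this]; exact one_ne_zero
  -- Both frames span the same fibre: were `D' z` zero, the relation `hrel` would contradict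
  -- positivity of the Gram determinant of `s'`.
  have hDz' : D' z ≠ 0 := by
    intro h0
    have h1 := hrel z hxU hxU'
    rw [h0, norm_zero] at h1
    have h2 := gramDeterminant_form_pos h (hs'.linearIndependent _ hxU')
    have h3 : 0 < ‖D z‖ ^ 2 := by positivity
    have h4 := mul_pos h2 h3
    rw [hx, h1] at h4
    simp at h4
  have hevU : ∀ᶠ y in 𝓝 z, (chartAt ℂ p).symm y ∈ U :=
    ((chartAt ℂ p).continuousAt_symm hz).eventually (hs.isOpen.mem_nhds hxU)
  have hevU' : ∀ᶠ y in 𝓝 z, (chartAt ℂ p).symm y ∈ U' :=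
    ((chartAt ℂ p).continuousAt_symm hz).eventually (hs'.isOpen.mem_nhds hxU')
  have hh := hDan.harmonicAt_log_norm hDz
  have hh' := hDan'.harmonicAt_log_norm hDz'
  have hC := contDiffAt_log_gramDeterminant h hs hz hxU
  set f : ℂ → ℝ := fun y => Real.log (gramDeterminant (h.form ((chartAt ℂ p).symm y))
      (fun i => s i ((chartAt ℂ p).symm y))) with hf
  -- The two potentials differ by `2 log ‖D'‖ - 2 log ‖D‖`, which is harmonic near `z`.
  have hcongr : (fun y => Real.log (gramDeterminant (h.form ((chartAt ℂ p).symm y))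
      (fun i => s' i ((chartAt ℂ p).symm y)))) =ᶠ[𝓝 z]
      f + ((2 : ℝ) • (fun y => Real.log ‖D' y‖) + (-2 : ℝ) • fun y => Real.log ‖D y‖) := by
    filter_upwards [hevU, hevU', hDan.continuousAt.eventually_ne hDz,
      hDan'.continuousAt.eventually_ne hDz'] with y h1 h2 h3 h4
    have h5 := congrArg Real.log (hrel y h1 h2)
    rw [Real.log_mul (gramDeterminant_form_pos h (hs'.linearIndependent _ h2)).ne'
      (pow_ne_zero 2 (norm_ne_zero_iff.2 h3)),
      Real.log_mul (gramDeterminant_form_pos h (hs.linearIndependent _ h1)).ne'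
      (pow_ne_zero 2 (norm_ne_zero_iff.2 h4)), Real.log_pow, Real.log_pow] at h5
    simp only [Pi.add_apply, Pi.smul_apply, smul_eq_mul, hf]
    push_cast at h5
    linarith
  rw [(InnerProductSpace.laplacian_congr_nhds hcongr).eq_of_nhds]
  have hc1 : ContDiffAt ℝ 2 ((2 : ℝ) • fun y => Real.log ‖D' y‖) z := hh'.1.const_smul (2 : ℝ)
  have hc2 : ContDiffAt ℝ 2 ((-2 : ℝ) • fun y => Real.log ‖D y‖) z := hh.1.const_smul (-2 : ℝ)
  have hc3 : ContDiffAt ℝ 2 (((2 : ℝ) • fun y => Real.log ‖D' y‖) +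
      (-2 : ℝ) • fun y => Real.log ‖D y‖) z := hc1.add hc2
  rw [hC.laplacian_add hc3, hc1.laplacian_add hc2,
    InnerProductSpace.laplacian_smul (2 : ℝ) hh'.1, InnerProductSpace.laplacian_smul (-2 : ℝ) hh.1,
    hh.2.eq_of_nhds, hh'.2.eq_of_nhds]
  simp

namespace Subbundle

theorem exists_isHolomorphicFrame_frame (W : V.Subbundle) (x : X) :
    ∃ U, x ∈ U ∧ V.IsHolomorphicFrame W.carrier (W.frame x) U :=
  (W.exists_frame x).choose_spec

/-- The frame in the definition of `chernCoeff` is chosen anew at each point, so its regularity in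
`z` is not visible there. This passes to one frame valid on an open set. -/
theorem chernCoeff_eq (W : V.Subbundle) (h : V.HermitianMetric) {s : Fin W.rank → ∀ x, V.Fiber x}
    {U : Set X} (hs : V.IsHolomorphicFrame W.carrier s U) {p : X} {z : ℂ}
    (hz : z ∈ (chartAt ℂ p).target) (hxU : (chartAt ℂ p).symm z ∈ U) :
    W.chernCoeff h p z = -(1 / (4 * Real.pi)) *
      Laplacian.laplacian (fun y => Real.log (gramDeterminant (h.form ((chartAt ℂ p).symm y))
        (fun i => s i ((chartAt ℂ p).symm y)))) z := by
  obtain ⟨U', hxU', hs'⟩ := W.exists_isHolomorphicFrame_frame ((chartAt ℂ p).symm z)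
  rw [← laplacian_log_gramDeterminant_eq h hs hs' hz hxU hxU']
  rfl

theorem chernCoeff_eventuallyEq (W : V.Subbundle) (h : V.HermitianMetric)
    {s : Fin W.rank → ∀ x, V.Fiber x}
    {U : Set X} (hs : V.IsHolomorphicFrame W.carrier s U) {p : X} {z : ℂ}
    (hz : z ∈ (chartAt ℂ p).target) (hxU : (chartAt ℂ p).symm z ∈ U) :
    W.chernCoeff h p =ᶠ[𝓝 z] fun z => -(1 / (4 * Real.pi)) *
      Laplacian.laplacian (fun y => Real.log (gramDeterminant (h.form ((chartAt ℂ p).symm y))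
        (fun i => s i ((chartAt ℂ p).symm y)))) z := by
  filter_upwards [(chartAt ℂ p).open_target.mem_nhds hz,
    ((chartAt ℂ p).continuousAt_symm hz).eventually (hs.isOpen.mem_nhds hxU)] with y hy hyU
  exact W.chernCoeff_eq h hs hy hyU

theorem continuousOn_chernCoeff (W : V.Subbundle) (h : V.HermitianMetric) (p : X) :
    ContinuousOn (W.chernCoeff h p) (chartAt ℂ p).target := by
  intro z hz
  obtain ⟨U, hxU, hs⟩ := W.exists_isHolomorphicFrame_frame ((chartAt ℂ p).symm z)
  refine ContinuousAt.continuousWithinAt ?_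
  refine ContinuousAt.congr_of_eventuallyEq ?_ (W.chernCoeff_eventuallyEq h hs hz hxU)
  exact continuousAt_const.mul (continuousAt_laplacian (contDiffAt_log_gramDeterminant h hs hz hxU))

theorem isTwoForm_chernCoeff (W : V.Subbundle) (h : V.HermitianMetric) :
    IsTwoForm (W.chernCoeff h) := by
  intro p q z hz hq
  obtain ⟨U, hxU, hs⟩ := W.exists_isHolomorphicFrame_frame ((chartAt ℂ p).symm z)
  have hzq := (chartAt ℂ q).map_source hq
  have hxq : (chartAt ℂ q).symm (chartAt ℂ q ((chartAt ℂ p).symm z)) ∈ U := by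
    rwa [(chartAt ℂ q).left_inv hq]
  rw [W.chernCoeff_eq h hs hz hxU, W.chernCoeff_eq h hs hzq hxq,
    laplacian_chart_change (q := q)
      (f := fun x => Real.log (gramDeterminant (h.form x) fun i => W.frame _ i x)) hz hq
      (contDiffAt_log_gramDeterminant h hs hzq hxq)]
  ring

theorem chernIntegral_eq (W : V.Subbundle) (h : V.HermitianMetric)
    (ρ : SmoothPartitionOfUnity X 𝓘(ℝ, ℂ) X Set.univ) :
    W.chernIntegral h ρ = chartIntegral ρ (W.chernCoeff h) := rfl

variable [CompactSpace X] [T2Space X]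

/-- The quotient of the two Gram determinants does not depend on the frame, since `|det A|²`
cancels; so it is a global positive function, and a singular potential with `G = 1`. The roles of
`h` and `h'` are exchangeable, so the inequality is in fact an equality. -/
theorem chernIntegral_le (W : V.Subbundle) (h h' : V.HermitianMetric)
    {ρ : SmoothPartitionOfUnity X 𝓘(ℝ, ℂ) X Set.univ}
    (hρ : ρ.IsSubordinate (fun p => (chartAt ℂ p).source)) :
    W.chernIntegral h ρ ≤ W.chernIntegral h' ρ := by
  have hpos : IsSingularPotential
      (fun x => gramDeterminant (h'.form x) (fun i => W.frame x i x) /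
        gramDeterminant (h.form x) (fun i => W.frame x i x))
      (fun p z => 4 * Real.pi * (W.chernCoeff h p z + (-1) * W.chernCoeff h' p z)) := by
    intro p z hz
    obtain ⟨U, hxU, hs⟩ := W.exists_isHolomorphicFrame_frame ((chartAt ℂ p).symm z)
    set s := W.frame ((chartAt ℂ p).symm z)
    have hC := contDiffAt_log_gramDeterminant h hs hz hxU
    have hC' := contDiffAt_log_gramDeterminant h' hs hz hxU
    refine ⟨fun _ => 1, _, analyticAt_const, hC'.sub hC, by simp, ?_, ?_⟩
    · filter_upwards [((chartAt ℂ p).continuousAt_symm hz).eventually (hs.isOpen.mem_nhds hxU)]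
        with y hy
      obtain ⟨U', hxU', hs'⟩ := W.exists_isHolomorphicFrame_frame ((chartAt ℂ p).symm y)
      have hb := hs.linearIndependent _ hy
      obtain ⟨A, hA⟩ := exists_matrix_of_mem_span
        (v := fun i => s i ((chartAt ℂ p).symm y))
        (v' := fun i => W.frame ((chartAt ℂ p).symm y) i ((chartAt ℂ p).symm y)) (fun j => by
        rw [hs.span_eq _ hy, ← hs'.span_eq _ hxU']
        exact Submodule.subset_span ⟨j, rfl⟩)
      have hA0 : ‖A.det‖ ^ 2 ≠ 0 := by
        intro h0
        have h1 := gramDeterminant_form_pos h (hs'.linearIndependent _ hxU')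
        rw [gramDeterminant_linearCombination (h.form _) hA, h0, zero_mul] at h1
        exact lt_irrefl _ h1
      rw [gramDeterminant_linearCombination (h.form _) hA,
        gramDeterminant_linearCombination (h'.form _) hA, mul_div_mul_left _ _ hA0,
        Real.exp_sub, Real.exp_log (gramDeterminant_form_pos h hb),
        Real.exp_log (gramDeterminant_form_pos h' hb)]
      simp
    · filter_upwards [W.chernCoeff_eventuallyEq h hs hz hxU,
        W.chernCoeff_eventuallyEq h' hs hz hxU,
        hC'.laplacian_sub_nhds hC] with y h1 h2 h3
      rw [h1, h2]
      refine Eq.trans ?_ h3.symm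
      have := Real.pi_pos.ne'
      simp only [Pi.sub_apply]
      field_simp
      ring
  have h1 := hpos.chartIntegral_nonpos hρ
  rw [chartIntegral_const_mul, chartIntegral_add_const_mul hρ _ (W.continuousOn_chernCoeff h)
    (W.continuousOn_chernCoeff h')] at h1
  have h2 := nonpos_of_mul_nonpos_right h1 (by have := Real.pi_pos; positivity)
  rw [chernIntegral_eq, chernIntegral_eq]
  linarith

theorem chernIntegral_eq_chernIntegral (W : V.Subbundle) (h h' : V.HermitianMetric)
    {ρ ρ' : SmoothPartitionOfUnity X 𝓘(ℝ, ℂ) X Set.univ}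
    (hρ : ρ.IsSubordinate (fun p => (chartAt ℂ p).source))
    (hρ' : ρ'.IsSubordinate (fun p => (chartAt ℂ p).source)) :
    W.chernIntegral h ρ = W.chernIntegral h' ρ' := by
  rw [le_antisymm (W.chernIntegral_le h h' hρ) (W.chernIntegral_le h' h hρ), chernIntegral_eq,
    chernIntegral_eq]
  exact chartIntegral_eq_of_isTwoForm hρ hρ' (W.continuousOn_chernCoeff h')
    (W.isTwoForm_chernCoeff h')

/-- `Classical.epsilon` selects the value for some metric and partition; since all values agree, any
convenient choice computes the degree. -/
theorem degree_eq_chernIntegral (W : V.Subbundle) (h : V.HermitianMetric)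
    {ρ : SmoothPartitionOfUnity X 𝓘(ℝ, ℂ) X Set.univ}
    (hρ : ρ.IsSubordinate (fun p => (chartAt ℂ p).source)) :
    W.degree = W.chernIntegral h ρ := by
  have hex : ∃ c : ℝ, ∃ (h : V.HermitianMetric)
      (ρ : SmoothPartitionOfUnity X 𝓘(ℝ, ℂ) X Set.univ),
      ρ.IsSubordinate (fun p => (chartAt ℂ p).source) ∧ W.chernIntegral h ρ = c :=
    ⟨_, h, ρ, hρ, rfl⟩
  obtain ⟨h', ρ', hρ', hc⟩ := Classical.epsilon_spec hex
  rw [degree, ← hc]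
  exact W.chernIntegral_eq_chernIntegral h' h hρ' hρ

end Subbundle

end HolomorphicVectorBundle

/-! ### Existence of Hermitian metrics and of subordinate partitions of unity. -/

namespace HolomorphicVectorBundle

open Filter Topology

variable {X : Type u} [TopologicalSpace X] [ChartedSpace ℂ X] [IsManifold 𝓘(ℂ, ℂ) ω X] {n : ℕ}
  {V : HolomorphicVectorBundle.{u, v} X n}

theorem contMDiffAt_real_of_complex {F : Type*} [NormedAddCommGroup F] [NormedSpace ℂ F]
    {f : X → F} {x : X} (hf : ContMDiffAt 𝓘(ℂ, ℂ) 𝓘(ℂ, F) ω f x) :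
    ContMDiffAt 𝓘(ℝ, ℂ) 𝓘(ℝ, F) ∞ f x := by
  have : IsManifold 𝓘(ℝ, ℂ) ∞ X := isManifold_real_of_complex
  have hx := (chartAt ℂ x).left_inv (mem_chart_source ℂ x)
  have h1 : ContDiffAt ℂ ω (fun y => f ((chartAt ℂ x).symm y)) (chartAt ℂ x x) :=
    contDiffAt_comp_chartAt_symm (mem_chart_target ℂ x) (by rwa [hx])
  have h2 : ContDiffAt ℝ ∞ (fun y => f ((chartAt ℂ x).symm y)) (chartAt ℂ x x) :=
    (h1.restrict_scalars ℝ).of_le le_top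
  have h3 : ContMDiffAt 𝓘(ℝ, ℂ) 𝓘(ℝ, ℂ) ∞ (chartAt ℂ x) x :=
    contMDiffOn_chart.contMDiffAt ((chartAt ℂ x).open_source.mem_nhds (mem_chart_source ℂ x))
  refine (h2.contMDiffAt.comp x h3).congr_of_eventuallyEq ?_
  filter_upwards [(chartAt ℂ x).open_source.mem_nhds (mem_chart_source ℂ x)] with y hy
  simp [(chartAt ℂ x).left_inv hy]

/-- The standard Hermitian form on `ℂ^n`. -/
noncomputable def stdHermitian (n : ℕ) : (Fin n → ℂ) →ₗ⋆[ℂ] (Fin n → ℂ) →ₗ[ℂ] ℂ :=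
  LinearMap.mk₂'ₛₗ (starRingEnd ℂ) (RingHom.id ℂ) (fun a b => ∑ i, starRingEnd ℂ (a i) * b i)
    (fun a a' b => by simp [add_mul, Finset.sum_add_distrib])
    (fun c a b => by simp [Finset.mul_sum, mul_assoc])
    (fun a b b' => by simp [mul_add, Finset.sum_add_distrib])
    (fun c a b => by simp [Finset.mul_sum, mul_left_comm])

theorem stdHermitian_apply (a b : Fin n → ℂ) :
    stdHermitian n a b = ∑ i, starRingEnd ℂ (a i) * b i := rfl

theorem stdHermitian_self_re (a : Fin n → ℂ) : (stdHermitian n a a).re = ∑ i, ‖a i‖ ^ 2 := by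
  rw [stdHermitian_apply, Complex.re_sum]
  refine Finset.sum_congr rfl fun i _ => ?_
  rw [← Complex.normSq_eq_conj_mul_self, Complex.ofReal_re, Complex.normSq_eq_norm_sq]

/-- The pull-back of the standard Hermitian form to the fibres by the trivialization around `p`. -/
noncomputable def localForm (V : HolomorphicVectorBundle.{u, v} X n) (p x : X) :
    V.Fiber x →ₗ⋆[ℂ] V.Fiber x →ₗ[ℂ] ℂ :=
  LinearMap.mk₂'ₛₗ (starRingEnd ℂ) (RingHom.id ℂ)
    (fun a b => stdHermitian n (V.coord p x a) (V.coord p x b))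
    (fun a a' b => by simp) (fun c a b => by simp) (fun a b b' => by simp) (fun c a b => by simp)

theorem localForm_apply (p x : X) (a b : V.Fiber x) :
    V.localForm p x a b = stdHermitian n (V.coord p x a) (V.coord p x b) := rfl

variable [CompactSpace X] [T2Space X]

/-- The Hermitian form on the fibres which a partition of unity glues from trivializations. -/
noncomputable def gluedForm (V : HolomorphicVectorBundle.{u, v} X n)
    (ρ : SmoothPartitionOfUnity X 𝓘(ℝ, ℂ) X Set.univ) (x : X) :
    V.Fiber x →ₗ⋆[ℂ] V.Fiber x →ₗ[ℂ] ℂ :=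
  ∑ p ∈ partitionIndices ρ, ((ρ p x : ℝ) : ℂ) • V.localForm p x

theorem gluedForm_apply (ρ : SmoothPartitionOfUnity X 𝓘(ℝ, ℂ) X Set.univ) (x : X)
    (a b : V.Fiber x) : V.gluedForm ρ x a b =
      ∑ p ∈ partitionIndices ρ, ((ρ p x : ℝ) : ℂ) * V.localForm p x a b := by
  simp [gluedForm, LinearMap.sum_apply]

theorem contMDiffAt_localForm {p x : X} {U : Set X} {s t : ∀ x, V.Fiber x} (hU : IsOpen U)
    (hs : V.IsHolomorphicOn s U) (ht : V.IsHolomorphicOn t U) (hxU : x ∈ U)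
    (hx : x ∈ V.baseSet p) :
    ContMDiffAt 𝓘(ℝ, ℂ) 𝓘(ℝ, ℂ) ∞ (fun y => V.localForm p y (s y) (t y)) x := by
  have h1 := contMDiffAt_real_of_complex (contMDiffAt_coord hU hs hxU hx)
  have h2 := contMDiffAt_real_of_complex (contMDiffAt_coord hU ht hxU hx)
  have h3 : ContDiff ℝ ∞ fun c : (Fin n → ℂ) × (Fin n → ℂ) => stdHermitian n c.1 c.2 := by
    simp only [stdHermitian_apply]
    refine ContDiff.sum fun i _ => ContDiff.mul ?_ ?_
    · exact Complex.conjCLE.contDiff.comp ((contDiff_apply ℝ ℂ i).comp contDiff_fst)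
    · exact (contDiff_apply ℝ ℂ i).comp contDiff_snd
  exact ContMDiffAt.comp (g := fun c : (Fin n → ℂ) × (Fin n → ℂ) => stdHermitian n c.1 c.2)
    (f := fun y => (V.coord p y (s y), V.coord p y (t y))) x
    (I' := 𝓘(ℝ, (Fin n → ℂ) × (Fin n → ℂ))) h3.contDiffAt.contMDiffAt
    (h1.prodMk_space h2)

/-- On a compact Riemann surface every holomorphic vector bundle has a Hermitian metric. -/
theorem nonempty_hermitianMetric (V : HolomorphicVectorBundle.{u, v} X n) :
    Nonempty V.HermitianMetric := by
  have : IsManifold 𝓘(ℝ, ℂ) ∞ X := isManifold_real_of_complex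
  obtain ⟨ρ, hρ⟩ := SmoothPartitionOfUnity.exists_isSubordinate 𝓘(ℝ, ℂ) isClosed_univ
    (fun p => V.baseSet p) V.isOpen_baseSet
    (fun x _ => Set.mem_iUnion.2 ⟨x, V.mem_baseSet x⟩)
  refine ⟨⟨V.gluedForm ρ, fun x a b => ?_, fun x a ha => ?_, fun U s t hU hs ht x hxU => ?_⟩⟩
  · rw [gluedForm_apply, gluedForm_apply, map_sum]
    refine Finset.sum_congr rfl fun p _ => ?_
    rw [map_mul, Complex.conj_ofReal, localForm_apply, localForm_apply, stdHermitian_apply,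
      stdHermitian_apply, map_sum]
    congr 1
    refine Finset.sum_congr rfl fun i _ => ?_
    rw [map_mul, Complex.conj_conj, mul_comm]
  · rw [gluedForm_apply, Complex.re_sum]
    simp only [Complex.re_ofReal_mul, localForm_apply, stdHermitian_self_re]
    obtain ⟨p, hp⟩ := ρ.exists_pos_of_mem (Set.mem_univ x)
    have hpI : p ∈ partitionIndices ρ := by
      by_contra h
      rw [partition_apply_eq_zero h] at hp
      exact lt_irrefl _ hp
    have hxp : x ∈ V.baseSet p := hρ p (subset_tsupport _ hp.ne')
    refine Finset.sum_pos' (fun q _ => mul_nonneg (ρ.nonneg q x)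
      (Finset.sum_nonneg fun i _ => sq_nonneg _)) ⟨p, hpI, mul_pos hp ?_⟩
    have hc : V.coord p x a ≠ 0 := by
      rw [← map_zero (V.coord p x)]
      exact (V.coord_injective hxp).ne ha
    obtain ⟨i, hi⟩ := Function.ne_iff.1 hc
    exact Finset.sum_pos' (fun i _ => sq_nonneg _)
      ⟨i, Finset.mem_univ i, pow_pos (norm_pos_iff.2 hi) 2⟩
  · refine ContMDiffAt.contMDiffWithinAt ?_
    simp only [gluedForm_apply]
    refine ContMDiffAt.sum fun p _ => ?_
    -- The local form is smooth only where the trivialization around `p` is defined; elsewhere `ρ p`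
    -- vanishes in a neighbourhood.
    by_cases hx : x ∈ tsupport (ρ p)
    · have h1 := contMDiffAt_localForm hU hs ht hxU (hρ p hx)
      have h2 : ContMDiffAt 𝓘(ℝ, ℂ) 𝓘(ℝ, ℂ) ∞ (fun y => ((ρ p y : ℝ) : ℂ)) x :=
        ContMDiffAt.comp x (I' := 𝓘(ℝ, ℝ)) (g := fun r : ℝ => (r : ℂ))
          Complex.ofRealCLM.contDiff.contDiffAt.contMDiffAt (ρ p).contMDiff.contMDiffAt
      exact (contDiff_mul.contDiffAt.contMDiffAt).comp x
        (I' := 𝓘(ℝ, ℂ × ℂ)) (h2.prodMk_space h1)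
    · have h1 : (fun y => ((ρ p y : ℝ) : ℂ) * V.localForm p y (s y) (t y)) =ᶠ[𝓝 x] fun _ => 0 := by
        filter_upwards [(isClosed_tsupport (ρ p)).isOpen_compl.mem_nhds hx] with y hy
        rw [image_eq_zero_of_notMem_tsupport hy]
        simp
      exact contMDiffAt_const.congr_of_eventuallyEq h1

theorem exists_partition_isSubordinate_chartAt :
    ∃ ρ : SmoothPartitionOfUnity X 𝓘(ℝ, ℂ) X Set.univ,
      ρ.IsSubordinate (fun p => (chartAt ℂ p).source) := by
  have : IsManifold 𝓘(ℝ, ℂ) ∞ X := isManifold_real_of_complex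
  exact SmoothPartitionOfUnity.exists_isSubordinate_chartAt_source 𝓘(ℝ, ℂ) X

end HolomorphicVectorBundle

/-! ### Kernels of holomorphic families of matrices: elimination over germs. -/

section SaturatedKernel

open Filter Topology Matrix

/-- In the discrete valuation ring of germs at `z₀`, divisibility is comparison of orders of
vanishing. -/
theorem exists_analytic_quotient {f g : ℂ → ℂ} {z₀ : ℂ} (hf : AnalyticAt ℂ f z₀)
    (hg : AnalyticAt ℂ g z₀) (hg0 : analyticOrderAt g z₀ ≠ ⊤)
    (hle : analyticOrderAt g z₀ ≤ analyticOrderAt f z₀) :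
    ∃ q : ℂ → ℂ, AnalyticAt ℂ q z₀ ∧ ∀ᶠ z in 𝓝 z₀, f z = q z * g z := by
  obtain ⟨m, hm⟩ := ENat.ne_top_iff_exists.1 hg0
  obtain ⟨g₁, hg₁, hg₁0, hgg₁⟩ := hg.analyticOrderAt_eq_natCast.1 hm.symm
  rw [← hm] at hle
  obtain ⟨f₁, hf₁, hff₁⟩ := (natCast_le_analyticOrderAt hf).1 hle
  refine ⟨fun z => f₁ z / g₁ z, hf₁.fun_div hg₁ hg₁0, ?_⟩
  filter_upwards [hgg₁, hff₁, hg₁.continuousAt.eventually_ne hg₁0] with z h1 h2 h3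
  rw [h1, h2]
  simp only [smul_eq_mul]
  field_simp

theorem linearIndependent_sub_smul {E ι : Type*} [AddCommGroup E] [Module ℂ E] {T : ι → E}
    (hT : LinearIndependent ℂ T) (a₀ : ι) (q : ι → ℂ) :
    LinearIndependent ℂ fun a : {a // a ≠ a₀} => T a - q a • T a₀ := by
  classical
  rw [linearIndependent_iff'] at hT ⊢
  intro s c hc a ha
  set d : ι → ℂ := fun b => if h : b ≠ a₀ then c ⟨b, h⟩ else - ∑ i ∈ s, c i * q i with hd
  have h1 : ∀ i : {a // a ≠ a₀}, d i = c i := fun i => by simp [hd, i.2]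
  have h2 : ∑ b ∈ insert a₀ (s.map ⟨Subtype.val, Subtype.val_injective⟩), d b • T b = 0 := by
    rw [Finset.sum_insert (by simp), Finset.sum_map]
    simp only [Function.Embedding.coeFn_mk, h1]
    have : d a₀ = - ∑ i ∈ s, c i * q i := by simp [hd]
    rw [this, ← hc, neg_smul, Finset.sum_smul]
    simp only [smul_sub, smul_smul, Finset.sum_sub_distrib]
    abel
  have h3 := hT _ d h2 a (by simp [ha, a.2])
  rwa [h1] at h3

/-- One elimination step for a single equation. If the equation vanishes identically on the `T a`,
nothing changes. Otherwise the `T a₀` on which it has least order serves as pivot: all other values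
are holomorphic multiples of the pivot value, and the vectors `T a - q a • T a₀` solve the equation
while staying independent at `z₀` itself. -/
theorem exists_saturated_kernel_step {n : ℕ} {z₀ : ℂ} {A : ℂ → Fin n → ℂ}
    (hA : ∀ i, AnalyticAt ℂ (fun z => A z i) z₀) {ι : Type} [Fintype ι]
    {T : ι → ℂ → Fin n → ℂ} (hT : ∀ a i, AnalyticAt ℂ (fun z => T a z i) z₀)
    (hTi : LinearIndependent ℂ fun a => T a z₀) :
    ∃ (κ : Type) (_ : Fintype κ) (S : κ → ℂ → Fin n → ℂ),
      (∀ a i, AnalyticAt ℂ (fun z => S a z i) z₀) ∧ LinearIndependent ℂ (fun a => S a z₀) ∧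
      ∀ᶠ z in 𝓝[≠] z₀, ∀ v, v ∈ Submodule.span ℂ (Set.range fun a => S a z) ↔
        v ∈ Submodule.span ℂ (Set.range fun a => T a z) ∧ A z ⬝ᵥ v = 0 := by
  classical
  set ℓ : ι → ℂ → ℂ := fun a z => A z ⬝ᵥ T a z with hℓ
  have hℓa : ∀ a, AnalyticAt ℂ (ℓ a) z₀ := fun a => by
    simp only [hℓ, dotProduct]
    exact Finset.analyticAt_fun_sum _ fun i _ => (hA i).fun_mul (hT a i)
  by_cases hz : ∀ a, ∀ᶠ z in 𝓝 z₀, ℓ a z = 0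
  · refine ⟨ι, inferInstance, T, hT, hTi, ?_⟩
    have := (eventually_all.2 hz).filter_mono (nhdsWithin_le_nhds (s := {z₀}ᶜ))
    filter_upwards [this] with z hz v
    refine ⟨fun hv => ⟨hv, ?_⟩, fun hv => hv.1⟩
    obtain ⟨c, rfl⟩ := (Submodule.mem_span_range_iff_exists_fun ℂ).1 hv
    rw [dotProduct_sum]
    refine Finset.sum_eq_zero fun a _ => ?_
    rw [dotProduct_smul]
    exact smul_eq_zero_of_right _ (hz a)
  · obtain ⟨a₁, ha₁⟩ := not_forall.1 hz
    have : Nonempty ι := ⟨a₁⟩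
    obtain ⟨a₀, ha₀⟩ := Finite.exists_min fun a => analyticOrderAt (ℓ a) z₀
    have htop : analyticOrderAt (ℓ a₀) z₀ ≠ ⊤ := by
      intro h
      have h1 := ha₀ a₁
      rw [h, top_le_iff, analyticOrderAt_eq_top] at h1
      exact ha₁ h1
    choose q hq hqe using fun a => exists_analytic_quotient (hℓa a) (hℓa a₀) htop (ha₀ a)
    refine ⟨{a // a ≠ a₀}, inferInstance, fun a z => T a z - q a z • T a₀ z, fun a i => ?_,
      linearIndependent_sub_smul hTi a₀ fun a => q a z₀, ?_⟩
    · simp only [Pi.sub_apply, Pi.smul_apply, smul_eq_mul]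
      exact (hT a i).fun_sub ((hq a).fun_mul (hT a₀ i))
    · have hne : ∀ᶠ z in 𝓝[≠] z₀, ℓ a₀ z ≠ 0 := by
        rcases (hℓa a₀).eventually_eq_zero_or_eventually_ne_zero with h | h
        · exact absurd (analyticOrderAt_eq_top.2 h) htop
        · exact h
      have hall := (eventually_all.2 hqe).filter_mono (nhdsWithin_le_nhds (s := {z₀}ᶜ))
      filter_upwards [hne, hall] with z h0 hqz v
      constructor
      · intro hv
        obtain ⟨c, rfl⟩ := (Submodule.mem_span_range_iff_exists_fun ℂ).1 hv
        refine ⟨Submodule.sum_mem _ fun a _ => Submodule.smul_mem _ _ (Submodule.sub_mem _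
          (Submodule.subset_span ⟨_, rfl⟩)
          (Submodule.smul_mem _ _ (Submodule.subset_span ⟨_, rfl⟩))), ?_⟩
        rw [dotProduct_sum]
        refine Finset.sum_eq_zero fun a _ => ?_
        rw [dotProduct_smul, dotProduct_sub, dotProduct_smul]
        have h1 : A z ⬝ᵥ T a z = q a z * (A z ⬝ᵥ T a₀ z) := hqz a
        rw [h1, smul_eq_mul, smul_eq_mul, sub_self, mul_zero]
      · rintro ⟨hv, hv0⟩
        obtain ⟨c, rfl⟩ := (Submodule.mem_span_range_iff_exists_fun ℂ).1 hv
        -- The equation at `v` is this sum times the pivot value, which is non-zero off `z₀`. Hence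
        -- replacing each `T a` by `T a - q a • T a₀` does not change `v`.
        have h1 : ∑ a, c a * q a z = 0 := by
          rw [dotProduct_sum] at hv0
          have h2 : ∀ a, A z ⬝ᵥ (c a • T a z) = c a * q a z * ℓ a₀ z := fun a => by
            rw [dotProduct_smul, smul_eq_mul, mul_assoc, ← hqz a]
          simp only [h2, ← Finset.sum_mul] at hv0
          exact (mul_eq_zero.1 hv0).resolve_right h0
        have h3 : ∑ a, c a • T a z = ∑ a, c a • (T a z - q a z • T a₀ z) := by
          simp only [smul_sub, smul_smul, Finset.sum_sub_distrib, ← Finset.sum_smul, h1, zero_smul,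
            sub_zero]
        rw [h3]
        refine Submodule.sum_mem _ fun a _ => Submodule.smul_mem _ _ ?_
        by_cases ha : a = a₀
        · subst ha
          have h4 : q a z = 1 := by
            have := hqz a
            exact mul_right_cancel₀ h0 (by rw [one_mul]; exact this.symm)
          rw [h4, one_smul, sub_self]
          exact Submodule.zero_mem _
        · exact Submodule.subset_span ⟨⟨a, ha⟩, rfl⟩

/-- The kernel of a holomorphic family of linear systems extends across a point to a holomorphic
family of subspaces of constant dimension. -/
theorem exists_saturated_kernel {n : ℕ} {z₀ : ℂ} {J : Type*} (s : Finset J)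
    {A : J → ℂ → Fin n → ℂ} (hA : ∀ j i, AnalyticAt ℂ (fun z => A j z i) z₀) :
    ∃ (κ : Type) (_ : Fintype κ) (S : κ → ℂ → Fin n → ℂ),
      (∀ a i, AnalyticAt ℂ (fun z => S a z i) z₀) ∧ LinearIndependent ℂ (fun a => S a z₀) ∧
      ∀ᶠ z in 𝓝[≠] z₀, ∀ v, v ∈ Submodule.span ℂ (Set.range fun a => S a z) ↔
        ∀ j ∈ s, A j z ⬝ᵥ v = 0 := by
  classical
  induction s using Finset.induction_on with
  | empty =>
    refine ⟨Fin n, inferInstance, fun a _ => Pi.basisFun ℂ (Fin n) a, fun a i => analyticAt_const,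
      (Pi.basisFun ℂ (Fin n)).linearIndependent, Eventually.of_forall fun z v => ?_⟩
    have hv : v ∈ Submodule.span ℂ (Set.range (Pi.basisFun ℂ (Fin n))) := by
      rw [(Pi.basisFun ℂ (Fin n)).span_eq]
      trivial
    exact ⟨fun _ => by simp, fun _ => hv⟩
  | insert j s hj ih =>
    obtain ⟨ι, _, T, hT, hTi, hTs⟩ := ih
    obtain ⟨κ, _, S, hS, hSi, hSs⟩ := exists_saturated_kernel_step (hA j) hT hTi
    refine ⟨κ, inferInstance, S, hS, hSi, ?_⟩
    filter_upwards [hTs, hSs] with z h1 h2 v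
    rw [h2, h1, Finset.forall_mem_insert]
    exact and_comm

end SaturatedKernel

/-! ### Punctured neighbourhoods and elementary local sections. -/

open Filter Topology in
theorem tendsto_chartAt_symm_punctured {X : Type u} [TopologicalSpace X] [ChartedSpace ℂ X]
    {p : X} {z : ℂ} (hz : z ∈ (chartAt ℂ p).target) :
    Tendsto (chartAt ℂ p).symm (𝓝[≠] z) (𝓝[≠] ((chartAt ℂ p).symm z)) := by
  refine tendsto_nhdsWithin_iff.2
    ⟨((chartAt ℂ p).continuousAt_symm hz).tendsto.mono_left nhdsWithin_le_nhds, ?_⟩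
  filter_upwards [self_mem_nhdsWithin,
    mem_nhdsWithin_of_mem_nhds ((chartAt ℂ p).open_target.mem_nhds hz)] with y hy hyt h
  exact hy ((chartAt ℂ p).symm.injOn hyt hz h)

open Filter Topology in
theorem tendsto_chartAt_punctured {X : Type u} [TopologicalSpace X] [ChartedSpace ℂ X] (x : X) :
    Tendsto (chartAt ℂ x) (𝓝[≠] x) (𝓝[≠] (chartAt ℂ x x)) := by
  refine tendsto_nhdsWithin_iff.2
    ⟨((chartAt ℂ x).continuousAt (mem_chart_source ℂ x)).tendsto.mono_left nhdsWithin_le_nhds, ?_⟩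
  filter_upwards [self_mem_nhdsWithin, mem_nhdsWithin_of_mem_nhds
    ((chartAt ℂ x).open_source.mem_nhds (mem_chart_source ℂ x))] with y hy hyt h
  exact hy ((chartAt ℂ x).injOn hyt (mem_chart_source ℂ x) h)

open Filter Topology in
theorem neBot_punctured_nhds {X : Type u} [TopologicalSpace X] [ChartedSpace ℂ X] (x : X) :
    (𝓝[≠] x).NeBot := by
  have h := tendsto_chartAt_symm_punctured (mem_chart_target ℂ x)
  rw [(chartAt ℂ x).left_inv (mem_chart_source ℂ x)] at h
  exact h.neBot

namespace HolomorphicVectorBundle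

open Filter Topology

variable {X : Type u} [TopologicalSpace X] [ChartedSpace ℂ X] {n : ℕ}
  {V : HolomorphicVectorBundle.{u, v} X n}

theorem IsHolomorphicOn.mono {s : ∀ x, V.Fiber x} {U U' : Set X} (hs : V.IsHolomorphicOn s U)
    (h : U' ⊆ U) : V.IsHolomorphicOn s U' := ContMDiffOn.mono hs h

theorem IsHolomorphicOn.add {s t : ∀ x, V.Fiber x} {U : Set X} (hs : V.IsHolomorphicOn s U)
    (ht : V.IsHolomorphicOn t U) : V.IsHolomorphicOn (fun x => s x + t x) U :=
  ContMDiffOn.add_section hs ht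

theorem IsHolomorphicOn.const_smul {s : ∀ x, V.Fiber x} {U : Set X} (c : ℂ)
    (hs : V.IsHolomorphicOn s U) : V.IsHolomorphicOn (fun x => c • s x) U :=
  ContMDiffOn.const_smul_section hs

theorem isHolomorphicOn_zero (U : Set X) : V.IsHolomorphicOn (fun _ => 0) U :=
  (Bundle.contMDiff_zeroSection ℂ V.Fiber).contMDiffOn

theorem isHolomorphicOn_vec (x₀ : X) (c : Fin n → ℂ) :
    V.IsHolomorphicOn (fun x => V.vec x₀ x c) (V.baseSet x₀) := by
  refine isHolomorphicOn_of_coord subset_rfl fun x hx => ?_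
  refine (contMDiffAt_const (c := c)).congr_of_eventuallyEq ?_
  filter_upwards [(V.isOpen_baseSet x₀).mem_nhds hx] with y hy
  exact V.coord_vec hy c

theorem finrank_fiber (x : X) : Module.finrank ℂ (V.Fiber x) = n := by
  have h : Function.Bijective (V.coord x x) :=
    ⟨V.coord_injective (V.mem_baseSet x), fun c => ⟨_, V.coord_vec (V.mem_baseSet x) c⟩⟩
  rw [(LinearEquiv.ofBijective _ h).finrank_eq, Module.finrank_fin_fun]

theorem finiteDimensional_fiber (x : X) : FiniteDimensional ℂ (V.Fiber x) :=
  FiniteDimensional.of_injective (V.coord x x) (V.coord_injective (V.mem_baseSet x))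

end HolomorphicVectorBundle

/-! ### The saturated kernel of `γ` as a holomorphic subbundle. -/

namespace QuadricBundle

open Filter Topology HolomorphicVectorBundle Matrix

variable {X : Type u} [TopologicalSpace X] [ChartedSpace ℂ X]
  {L : HolomorphicVectorBundle.{u, w} X 1} {n : ℕ}

/-- The entries of the matrix of `γ` in the trivializations around `x₀`. -/
noncomputable def entry (Q : QuadricBundle.{u, v, w} L n) (x₀ x : X) (i j : Fin n) : ℂ :=
  L.coord x₀ x (Q.γ x (Q.V.vec x₀ x (Pi.single i 1)) (Q.V.vec x₀ x (Pi.single j 1))) 0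

theorem coord_γ_vec (Q : QuadricBundle.{u, v, w} L n) (x₀ x : X) (c d : Fin n → ℂ) :
    L.coord x₀ x (Q.γ x (Q.V.vec x₀ x c) (Q.V.vec x₀ x d)) 0 =
      ∑ j, d j * ∑ i, Q.entry x₀ x i j * c i := by
  conv_lhs => rw [pi_eq_sum_univ' c, pi_eq_sum_univ' d]
  simp only [map_sum, map_smul, LinearMap.sum_apply, LinearMap.smul_apply, Finset.sum_apply,
    Pi.smul_apply, smul_eq_mul, entry, Finset.mul_sum]
  refine Finset.sum_congr rfl fun j _ => Finset.sum_congr rfl fun i _ => ?_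
  ring

theorem γ_eq_zero_iff (Q : QuadricBundle.{u, v, w} L n) {x₀ x : X} (hx : x ∈ Q.V.baseSet x₀)
    (hxL : x ∈ L.baseSet x₀) (a : Q.V.Fiber x) :
    Q.γ x a = 0 ↔ ∀ j, (fun i => Q.entry x₀ x i j) ⬝ᵥ Q.V.coord x₀ x a = 0 := by
  constructor
  · intro h j
    have := Q.coord_γ_vec x₀ x (Q.V.coord x₀ x a) (Pi.single j 1)
    rw [Q.V.vec_coord hx, h] at this
    simpa [Pi.single_apply, dotProduct] using this.symm
  · intro h
    ext b
    apply L.coord_injective hxL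
    ext i
    obtain rfl : i = 0 := Subsingleton.elim _ _
    rw [← Q.V.vec_coord hx a, ← Q.V.vec_coord hx b, Q.coord_γ_vec]
    simp only [dotProduct] at h
    simp [h]

variable [IsManifold 𝓘(ℂ, ℂ) ω X]

theorem analyticAt_entry (Q : QuadricBundle.{u, v, w} L n) {x₀ p : X} {z : ℂ}
    (hz : z ∈ (chartAt ℂ p).target) (hx : (chartAt ℂ p).symm z ∈ Q.V.baseSet x₀)
    (hxL : (chartAt ℂ p).symm z ∈ L.baseSet x₀) (i j : Fin n) :
    AnalyticAt ℂ (fun y => Q.entry x₀ ((chartAt ℂ p).symm y) i j) z := by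
  have h := Q.holomorphic _ _ _ (Q.V.isOpen_baseSet x₀) (isHolomorphicOn_vec x₀ (Pi.single i 1))
    (isHolomorphicOn_vec x₀ (Pi.single j 1))
  exact analyticAt_pi_iff.1 (analyticAt_coord (Q.V.isOpen_baseSet x₀) h hz hx hxL) 0

/-- Near every point there are holomorphic sections which are pointwise linearly independent and
span the kernel of `γ` away from the point. -/
theorem exists_local_kernel_frame (Q : QuadricBundle.{u, v, w} L n) (x₀ : X) :
    ∃ (k : ℕ) (t : Fin k → ∀ x, Q.V.Fiber x) (U : Set X), x₀ ∈ U ∧ IsOpen U ∧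
      (∀ a, Q.V.IsHolomorphicOn (t a) U) ∧ (∀ x ∈ U, LinearIndependent ℂ fun a => t a x) ∧
      (∀ x ∈ U, ∀ a, Q.γ x (t a x) = 0) ∧
      ∀ x ∈ U, x ≠ x₀ → Submodule.span ℂ (Set.range fun a => t a x) = LinearMap.ker (Q.γ x) := by
  classical
  set φ := chartAt ℂ x₀ with hφ
  have hz := mem_chart_target ℂ x₀
  have hxs := mem_chart_source ℂ x₀
  have hxz : φ.symm (φ x₀) = x₀ := φ.left_inv hxs
  have hA : ∀ j i, AnalyticAt ℂ (fun z => Q.entry x₀ (φ.symm z) i j) (φ x₀) := fun j i =>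
    Q.analyticAt_entry hz (by rw [hxz]; exact Q.V.mem_baseSet x₀)
      (by rw [hxz]; exact L.mem_baseSet x₀) i j
  obtain ⟨κ, _, S', hS', hSi', hSs'⟩ := exists_saturated_kernel (Finset.univ : Finset (Fin n))
    (A := fun j z i => Q.entry x₀ (φ.symm z) i j) hA
  obtain ⟨k, ⟨e⟩⟩ : ∃ k, Nonempty (Fin k ≃ κ) := ⟨_, ⟨(Fintype.equivFin κ).symm⟩⟩
  set S : Fin k → ℂ → Fin n → ℂ := fun a => S' (e a) with hSdef
  have hS : ∀ a i, AnalyticAt ℂ (fun z => S a z i) (φ x₀) := fun a i => hS' (e a) i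
  have hSi : LinearIndependent ℂ fun a => S a (φ x₀) := hSi'.comp e e.injective
  have hSr : ∀ z, Set.range (fun a => S a z) = Set.range fun a => S' a z := fun z =>
    e.surjective.range_comp fun a => S' a z
  have hSs : ∀ᶠ z in 𝓝[≠] (φ x₀), ∀ v, v ∈ Submodule.span ℂ (Set.range fun a => S a z) ↔
      ∀ j, (fun i => Q.entry x₀ (φ.symm z) i j) ⬝ᵥ v = 0 := by
    filter_upwards [hSs'] with z h v
    rw [hSr, h]
    simp
  have hSa : ∀ a, AnalyticAt ℂ (S a) (φ x₀) := fun a => analyticAt_pi_iff.2 (hS a)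
  have hzero : ∀ᶠ z in 𝓝 (φ x₀), ∀ a j, (fun i => Q.entry x₀ (φ.symm z) i j) ⬝ᵥ S a z = 0 := by
    rw [eventually_all]; intro a
    rw [eventually_all]; intro j
    have han : AnalyticAt ℂ (fun z => (fun i => Q.entry x₀ (φ.symm z) i j) ⬝ᵥ S a z) (φ x₀) := by
      simp only [dotProduct]
      exact Finset.analyticAt_fun_sum _ fun i _ => (hA j i).fun_mul (hS a i)
    -- By the identity theorem, the kernel equations, known off the point, also hold at the point.
    refine han.frequently_zero_iff_eventually_zero.1 (Eventually.frequently ?_)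
    filter_upwards [hSs] with z h
    exact (h _).1 (Submodule.subset_span ⟨a, rfl⟩) j
  have hind : ∀ᶠ z in 𝓝 (φ x₀), LinearIndependent ℂ fun a => S a z := by
    have hc : ContinuousAt (fun z a => S a z) (φ x₀) :=
      continuousAt_pi.2 fun a => (hSa a).continuousAt
    exact hc.eventually hSi.eventually
  have han : ∀ᶠ z in 𝓝 (φ x₀), ∀ a, AnalyticAt ℂ (S a) z :=
    eventually_all.2 fun a => (hSa a).eventually_analyticAt
  have hall : ∀ᶠ x in 𝓝 x₀, x ∈ φ.source ∧ x ∈ Q.V.baseSet x₀ ∧ x ∈ L.baseSet x₀ ∧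
      (∀ a, AnalyticAt ℂ (S a) (φ x)) ∧ (LinearIndependent ℂ fun a => S a (φ x)) ∧
      (∀ a j, (fun i => Q.entry x₀ (φ.symm (φ x)) i j) ⬝ᵥ S a (φ x) = 0) ∧
      (x ≠ x₀ → ∀ v, v ∈ Submodule.span ℂ (Set.range fun a => S a (φ x)) ↔
        ∀ j, (fun i => Q.entry x₀ (φ.symm (φ x)) i j) ⬝ᵥ v = 0) := by
    have hcont := (φ.continuousAt hxs).tendsto
    filter_upwards [φ.open_source.mem_nhds hxs, (Q.V.isOpen_baseSet x₀).mem_nhds (Q.V.mem_baseSet x₀),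
      (L.isOpen_baseSet x₀).mem_nhds (L.mem_baseSet x₀), hcont.eventually han,
      hcont.eventually hind, hcont.eventually hzero,
      eventually_nhdsWithin_iff.1 ((tendsto_chartAt_punctured x₀).eventually hSs)]
      with x h1 h2 h3 h4 h5 h6 h7
    exact ⟨h1, h2, h3, h4, h5, h6, h7⟩
  obtain ⟨U, hU, hUo, hxU⟩ := eventually_nhds_iff.1 hall
  refine ⟨k, fun a x => Q.V.vec x₀ x (S a (φ x)), U, hxU, hUo, fun a => ?_, fun x hx => ?_,
    fun x hx a => ?_, fun x hx hne => ?_⟩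
  · refine isHolomorphicOn_of_coord (fun x hx => (hU x hx).2.1) fun x hx => ?_
    have h1 : ContMDiffAt 𝓘(ℂ, ℂ) 𝓘(ℂ, ℂ) ω φ x :=
      contMDiffOn_chart.contMDiffAt (φ.open_source.mem_nhds (hU x hx).1)
    have h2 : ContMDiffAt 𝓘(ℂ, ℂ) 𝓘(ℂ, Fin n → ℂ) ω (S a) (φ x) :=
      ((hU x hx).2.2.2.1 a).contDiffAt.contMDiffAt
    refine (h2.comp x h1).congr_of_eventuallyEq ?_
    filter_upwards [(Q.V.isOpen_baseSet x₀).mem_nhds (hU x hx).2.1] with y hy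
    exact Q.V.coord_vec hy _
  · have h1 : Function.LeftInverse (Q.V.coord x₀ x) (Q.V.vec x₀ x) :=
      Q.V.coord_vec (hU x hx).2.1
    exact (hU x hx).2.2.2.2.1.map' _ (LinearMap.ker_eq_bot.2 h1.injective)
  · obtain ⟨h1, h2, h3, -, -, h6, -⟩ := hU x hx
    rw [Q.γ_eq_zero_iff h2 h3, Q.V.coord_vec h2]
    rw [φ.left_inv h1] at h6
    exact h6 a
  · obtain ⟨h1, h2, h3, -, -, -, h7⟩ := hU x hx
    rw [φ.left_inv h1] at h7
    ext v
    rw [LinearMap.mem_ker, Q.γ_eq_zero_iff h2 h3, ← h7 hne]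
    have h8 : Set.range (fun a => Q.V.vec x₀ x (S a (φ x))) =
        Q.V.vec x₀ x '' Set.range fun a => S a (φ x) := by
      rw [← Set.range_comp]; rfl
    rw [h8, Submodule.span_image]
    constructor
    · rintro ⟨c, hc, rfl⟩
      rwa [Q.V.coord_vec h2]
    · intro h
      exact ⟨_, h, Q.V.vec_coord h2 v⟩

/-- The fibre at `x` of the saturation of the kernel of `γ`: the values of local holomorphic
sections in the kernel. -/
def kernelFiber (Q : QuadricBundle.{u, v, w} L n) (x : X) : Submodule ℂ (Q.V.Fiber x) where
  carrier := {a | ∃ (U : Set X) (s : ∀ x, Q.V.Fiber x), IsOpen U ∧ x ∈ U ∧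
    Q.V.IsHolomorphicOn s U ∧ s x = a ∧ ∀ y ∈ U, Q.γ y (s y) = 0}
  add_mem' := by
    rintro _ _ ⟨U, s, hU, hxU, hs, rfl, hs0⟩ ⟨U', s', hU', hxU', hs', rfl, hs0'⟩
    exact ⟨U ∩ U', _, hU.inter hU', ⟨hxU, hxU'⟩,
      (hs.mono Set.inter_subset_left).add (hs'.mono Set.inter_subset_right), rfl,
      fun y hy => by rw [map_add, hs0 y hy.1, hs0' y hy.2, add_zero]⟩
  zero_mem' := ⟨Set.univ, _, isOpen_univ, trivial, isHolomorphicOn_zero _, rfl,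
    fun y _ => map_zero _⟩
  smul_mem' := by
    rintro c _ ⟨U, s, hU, hxU, hs, rfl, hs0⟩
    exact ⟨U, _, hU, hxU, hs.const_smul c, rfl, fun y hy => by rw [map_smul, hs0 y hy, smul_zero]⟩

theorem kernelFiber_le_ker (Q : QuadricBundle.{u, v, w} L n) (x : X) :
    Q.kernelFiber x ≤ LinearMap.ker (Q.γ x) := by
  rintro _ ⟨U, s, -, hxU, -, rfl, hs⟩
  exact hs x hxU

/-- The local sections spanning the kernel off `x₀` belong to the saturation by definition. Only at
`x₀` could it be larger, and there it is not, since independence persists at nearby points. -/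
theorem exists_kernelFiber_frame (Q : QuadricBundle.{u, v, w} L n) (x₀ : X) :
    ∃ (k : ℕ) (t : Fin k → ∀ x, Q.V.Fiber x) (U : Set X), x₀ ∈ U ∧
      Q.V.IsHolomorphicFrame Q.kernelFiber t U ∧
      ∀ x ∈ U, x ≠ x₀ → Q.kernelFiber x = LinearMap.ker (Q.γ x) := by
  obtain ⟨k, t, U, hxU, hU, ht, hti, ht0, hts⟩ := Q.exists_local_kernel_frame x₀
  have hle : ∀ x ∈ U, Submodule.span ℂ (Set.range fun a => t a x) ≤ Q.kernelFiber x := by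
    intro x hx
    rw [Submodule.span_le]
    rintro _ ⟨a, rfl⟩
    exact ⟨U, t a, hU, hx, ht a, rfl, fun y hy => ht0 y hy a⟩
  have heq : ∀ x ∈ U, x ≠ x₀ → Q.kernelFiber x = LinearMap.ker (Q.γ x) := fun x hx hne =>
    le_antisymm (Q.kernelFiber_le_ker x) ((hts x hx hne) ▸ hle x hx)
  refine ⟨k, t, U, hxU, ⟨hU, ht, hti, fun x hx => le_antisymm (hle x hx) ?_⟩, heq⟩
  by_cases hne : x = x₀
  · subst hne
    rintro _ ⟨U', s, hU', hxU', hs, rfl, hs0⟩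
    by_contra hmem
    -- A kernel section outside the span at `x` would form an independent family with the frame at
    -- nearby points `y ≠ x` too, where the frame already spans the whole kernel.
    have hopt : LinearIndependent ℂ fun o : Option (Fin k) =>
        Q.V.coord x x (Option.casesOn' o (s x) fun a => t a x) :=
      (linearIndependent_option'.2 ⟨hti x hx, hmem⟩).map' _
        (LinearMap.ker_eq_bot.2 (Q.V.coord_injective (Q.V.mem_baseSet x)))
    have hcont : ContinuousAt (fun (y : X) (o : Option (Fin k)) =>
        Q.V.coord x y (Option.casesOn' o (s y) fun a => t a y)) x := by
      refine continuousAt_pi.2 fun o => ?_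
      cases o with
      | none => exact (contMDiffAt_coord hU' hs hxU' (Q.V.mem_baseSet x)).continuousAt
      | some a => exact (contMDiffAt_coord hU (ht a) hx (Q.V.mem_baseSet x)).continuousAt
    have hev := (hcont.eventually hopt.eventually).filter_mono (nhdsWithin_le_nhds (s := {x}ᶜ))
    have := neBot_punctured_nhds x
    have hU2 : ∀ᶠ y in 𝓝[≠] x, y ∈ U ∧ y ∈ U' ∧ y ≠ x := by
      filter_upwards [mem_nhdsWithin_of_mem_nhds (hU.mem_nhds hx),
        mem_nhdsWithin_of_mem_nhds (hU'.mem_nhds hxU'), self_mem_nhdsWithin] with y h1 h2 h3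
      exact ⟨h1, h2, h3⟩
    obtain ⟨y, h1, hyU, hyU', hyne⟩ := (hev.and hU2).exists
    have h2 := (linearIndependent_option'.1 (LinearIndependent.of_comp (Q.V.coord x y) h1)).2
    apply h2
    rw [hts y hyU hyne]
    exact hs0 y hyU'
  · rw [hts x hx hne]
    exact Q.kernelFiber_le_ker x

variable [ConnectedSpace X]

theorem finrank_kernelFiber (Q : QuadricBundle.{u, v, w} L n) (x y : X) :
    Module.finrank ℂ (Q.kernelFiber x) = Module.finrank ℂ (Q.kernelFiber y) := by
  have : IsLocallyConstant fun x => Module.finrank ℂ (Q.kernelFiber x) := by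
    rw [IsLocallyConstant.iff_eventually_eq]
    intro x
    obtain ⟨k, t, U, hxU, ht, -⟩ := Q.exists_kernelFiber_frame x
    have hk : ∀ y ∈ U, Module.finrank ℂ (Q.kernelFiber y) = k := fun y hy => by
      rw [← ht.span_eq y hy, finrank_span_eq_card (ht.linearIndependent y hy), Fintype.card_fin]
    filter_upwards [ht.isOpen.mem_nhds hxU] with y hy
    rw [hk y hy, hk x hxU]
  exact this.apply_eq_of_preconnectedSpace x y

/-- The saturation of the kernel of `γ`, as a holomorphic subbundle. -/
noncomputable def kernelBundle (Q : QuadricBundle.{u, v, w} L n) : Q.V.Subbundle where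
  carrier := Q.kernelFiber
  rank := Module.finrank ℂ (Q.kernelFiber (Classical.arbitrary X))
  exists_frame x := by
    obtain ⟨k, t, U, hxU, ht, -⟩ := Q.exists_kernelFiber_frame x
    have hk : k = Module.finrank ℂ (Q.kernelFiber (Classical.arbitrary X)) := by
      rw [Q.finrank_kernelFiber _ x, ← ht.span_eq x hxU,
        finrank_span_eq_card (ht.linearIndependent x hxU), Fintype.card_fin]
    subst hk
    exact ⟨t, U, hxU, ht⟩

theorem finrank_kernelFiber_eq_rank (Q : QuadricBundle.{u, v, w} L n) (x : X) :
    Module.finrank ℂ (Q.kernelFiber x) = Q.kernelBundle.rank := Q.finrank_kernelFiber _ _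

theorem eventually_kernelFiber_eq_ker (Q : QuadricBundle.{u, v, w} L n) (x : X) :
    ∀ᶠ y in 𝓝[≠] x, Q.kernelFiber y = LinearMap.ker (Q.γ y) := by
  obtain ⟨k, t, U, hxU, ht, h⟩ := Q.exists_kernelFiber_frame x
  filter_upwards [self_mem_nhdsWithin, mem_nhdsWithin_of_mem_nhds (ht.isOpen.mem_nhds hxU)]
    with y hy hyU
  exact h y hyU hy

/-- The saturated kernel lies in the kernel at every point, which bounds the rank of `γ` everywhere;
equality of the two near any point, off the point itself, shows that the bound is attained. -/
theorem kernelBundle_rank_add_rankγ (Q : QuadricBundle.{u, v, w} L n) :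
    Q.kernelBundle.rank + Q.rankγ = n := by
  have hfd : ∀ x, FiniteDimensional ℂ (Q.V.Fiber x) := finiteDimensional_fiber
  have hrn : ∀ x, Module.finrank ℂ (LinearMap.range (Q.γ x)) +
      Module.finrank ℂ (LinearMap.ker (Q.γ x)) = n := fun x => by
    rw [LinearMap.finrank_range_add_finrank_ker, finrank_fiber]
  have hle : ∀ x, Module.finrank ℂ (LinearMap.range (Q.γ x)) ≤ n - Q.kernelBundle.rank := by
    intro x
    have h1 := Submodule.finrank_mono (Q.kernelFiber_le_ker x)
    rw [Q.finrank_kernelFiber_eq_rank] at h1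
    have := hrn x
    omega
  have hx := Classical.arbitrary X
  have := neBot_punctured_nhds hx
  obtain ⟨y, hy⟩ := (Q.eventually_kernelFiber_eq_ker hx).exists
  have h2 := hrn y
  rw [← hy, Q.finrank_kernelFiber_eq_rank] at h2
  have h3 : Q.rankγ = n - Q.kernelBundle.rank := by
    refine le_antisymm (ciSup_le hle) ?_
    have h4 : Module.finrank ℂ (LinearMap.range (Q.γ y)) ≤ Q.rankγ :=
      le_ciSup (f := fun x => Module.finrank ℂ (LinearMap.range (Q.γ x)))
        ⟨_, Set.forall_mem_range.2 hle⟩ y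
    omega
  omega

theorem rankγ_pos (Q : QuadricBundle.{u, v, w} L n) : 0 < Q.rankγ := by
  have hfd : ∀ x, FiniteDimensional ℂ (Q.V.Fiber x) := finiteDimensional_fiber
  have hle : ∀ x, Module.finrank ℂ (LinearMap.range (Q.γ x)) ≤ n := fun x => by
    have := LinearMap.finrank_range_add_finrank_ker (Q.γ x)
    rw [finrank_fiber] at this
    omega
  obtain ⟨x, hx⟩ := Q.ne_zero
  have h4 : Module.finrank ℂ (LinearMap.range (Q.γ x)) ≤ Q.rankγ :=
    le_ciSup (f := fun x => Module.finrank ℂ (LinearMap.range (Q.γ x)))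
      ⟨_, Set.forall_mem_range.2 hle⟩ x
  refine lt_of_lt_of_le (Module.finrank_pos_iff.2 ?_) h4
  rw [Submodule.nontrivial_iff_ne_bot]
  exact fun h => hx (LinearMap.range_eq_bot.1 h)

end QuadricBundle

/-! ### The discriminant of the form induced on a quotient: linear algebra. -/

section AdaptedBasis

open Matrix

variable {E F : Type*} [AddCommGroup E] [Module ℂ E] [AddCommGroup F] [Module ℂ F]

/-- The squared norm, with respect to Hermitian forms `h` on `E` and `m` on `F`, of the
discriminant that a bilinear form `g : E × E → F` induces on the quotient of `E` by the span of
`b ∘ inl`, computed with the family `b` and the coordinate `lam` on `F` dual to `e`. -/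
noncomputable def discriminantNorm (h : E →ₗ⋆[ℂ] E →ₗ[ℂ] ℂ) (m : F →ₗ⋆[ℂ] F →ₗ[ℂ] ℂ)
    (g : E →ₗ[ℂ] E →ₗ[ℂ] F) {k r : ℕ} (b : Fin k ⊕ Fin r → E) (e : F) (lam : F →ₗ[ℂ] ℂ) : ℝ :=
  ‖(Matrix.of fun i j => lam (g (b (Sum.inr i)) (b (Sum.inr j)))).det‖ ^ 2 *
    gramDeterminant m (fun _ : Fin 1 => e) ^ r *
    gramDeterminant h (fun a => b (Sum.inl a)) ^ 2 / gramDeterminant h b ^ 2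

/-- The determinant has degree `r` in the coordinate on `F`, so the factors `|lam e'|^(2r)` cancel;
this is why the Gram determinant of `e` carries the exponent `r`. -/
theorem discriminantNorm_change_coordinate (h : E →ₗ⋆[ℂ] E →ₗ[ℂ] ℂ) (m : F →ₗ⋆[ℂ] F →ₗ[ℂ] ℂ)
    (g : E →ₗ[ℂ] E →ₗ[ℂ] F) {k r : ℕ} (b : Fin k ⊕ Fin r → E) {e e' : F} {lam lam' : F →ₗ[ℂ] ℂ}
    (he : ∀ y, y = lam y • e) (he' : ∀ y, y = lam' y • e') :
    discriminantNorm h m g b e' lam' = discriminantNorm h m g b e lam := by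
  have h1 : (Matrix.of fun i j => lam (g (b (Sum.inr i)) (b (Sum.inr j)))) =
      lam e' • Matrix.of fun i j => lam' (g (b (Sum.inr i)) (b (Sum.inr j))) := by
    ext i j
    simp only [Matrix.of_apply, Matrix.smul_apply, smul_eq_mul]
    conv_lhs => rw [he' (g (b (Sum.inr i)) (b (Sum.inr j))), map_smul, smul_eq_mul]
    rw [mul_comm]
  have h2 : gramDeterminant m (fun _ : Fin 1 => e') =
      ‖lam e'‖ ^ 2 * gramDeterminant m (fun _ : Fin 1 => e) := by
    rw [gramDeterminant_linearCombination m (A := Matrix.of fun _ _ : Fin 1 => lam e')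
      (v := fun _ => e) (v' := fun _ => e') fun j => by simpa using he e']
    simp
  unfold discriminantNorm
  rw [h1, h2, Matrix.det_smul, norm_mul, norm_pow, Fintype.card_fin]
  ring

/-- The change of basis is block triangular with diagonal blocks `A` and `D`. The discriminant gains
`(det D)²`, and the Gram determinants gain `|det A|²` and `|det A|² |det D|²`; with the chosen
exponents all factors cancel. Only `K ≤ ker g` is assumed, so this also covers points where the rank
of `γ` drops. -/
theorem discriminantNorm_change_basis {h : E →ₗ⋆[ℂ] E →ₗ[ℂ] ℂ} (m : F →ₗ⋆[ℂ] F →ₗ[ℂ] ℂ)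
    (hsymm : ∀ a b, starRingEnd ℂ (h a b) = h b a) (hpos : ∀ a, a ≠ 0 → 0 < (h a a).re)
    {g : E →ₗ[ℂ] E →ₗ[ℂ] F} (hg : ∀ a b, g a b = g b a) {k r : ℕ} {b b' : Fin k ⊕ Fin r → E}
    {K : Submodule ℂ E} (hK : K ≤ LinearMap.ker g)
    (hb' : LinearIndependent ℂ b')
    (hbs : Submodule.span ℂ (Set.range b) = ⊤)
    (hbK : Submodule.span ℂ (Set.range fun a => b (Sum.inl a)) = K)
    (hbK' : Submodule.span ℂ (Set.range fun a => b' (Sum.inl a)) = K)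
    (e : F) (lam : F →ₗ[ℂ] ℂ) :
    discriminantNorm h m g b' e lam = discriminantNorm h m g b e lam := by
  obtain ⟨A, hA⟩ := exists_matrix_of_mem_span (v := fun a => b (Sum.inl a))
    (v' := fun a => b' (Sum.inl a)) fun j => by
      rw [hbK, ← hbK']; exact Submodule.subset_span ⟨j, rfl⟩
  obtain ⟨T, hT⟩ := exists_matrix_of_mem_span (v := b) (v' := b') fun j => by
    rw [hbs]; trivial
  set B : Matrix (Fin k) (Fin r) ℂ := fun i j => T (Sum.inl i) (Sum.inr j) with hB
  set D : Matrix (Fin r) (Fin r) ℂ := fun i j => T (Sum.inr i) (Sum.inr j) with hD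
  have hT' : ∀ j, b' j = ∑ i, Matrix.fromBlocks A B 0 D i j • b i := by
    rintro (j | j)
    · rw [Fintype.sum_sum_type]
      simpa using hA j
    · rw [hT, Fintype.sum_sum_type, Fintype.sum_sum_type]
      rfl
  have hinl : ∀ a y, g (b (Sum.inl a)) y = 0 := fun a y => by
    have : b (Sum.inl a) ∈ LinearMap.ker g := hK (hbK ▸ Submodule.subset_span ⟨a, rfl⟩)
    rw [LinearMap.mem_ker.1 this, LinearMap.zero_apply]
  have hinl' : ∀ a y, g y (b (Sum.inl a)) = 0 := fun a y => by rw [hg, hinl]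
  have h1 : (Matrix.of fun i j => lam (g (b' (Sum.inr i)) (b' (Sum.inr j)))) =
      Dᵀ * (Matrix.of fun i j => lam (g (b (Sum.inr i)) (b (Sum.inr j)))) * D := by
    ext i j
    simp only [Matrix.of_apply, Matrix.mul_apply, Matrix.transpose_apply, hT',
      Fintype.sum_sum_type, map_add, map_sum, map_smul, LinearMap.add_apply, LinearMap.sum_apply,
      LinearMap.smul_apply, hinl, hinl', smul_zero, Finset.sum_const_zero, zero_add,
      Matrix.fromBlocks_apply₂₂, smul_eq_mul, Finset.sum_mul, Finset.mul_sum]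
    refine Finset.sum_congr rfl fun a _ => Finset.sum_congr rfl fun c _ => ?_
    ring
  have h2 : gramDeterminant h b' = ‖A.det‖ ^ 2 * ‖D.det‖ ^ 2 * gramDeterminant h b := by
    rw [gramDeterminant_linearCombination h hT', Matrix.det_fromBlocks_zero₂₁, norm_mul, mul_pow]
  have h3 : gramDeterminant h (fun a => b' (Sum.inl a)) =
      ‖A.det‖ ^ 2 * gramDeterminant h (fun a => b (Sum.inl a)) :=
    gramDeterminant_linearCombination h hA
  have h4 := gramDeterminant_pos hsymm hpos hb'
  have hA0 : ‖A.det‖ ≠ 0 := by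
    intro h0; rw [h2, h0] at h4; simp at h4
  have hD0 : ‖D.det‖ ≠ 0 := by
    intro h0; rw [h2, h0] at h4; simp at h4
  have hb0 : gramDeterminant h b ≠ 0 := by
    intro h0; rw [h2, h0] at h4; simp at h4
  unfold discriminantNorm
  rw [h1, h2, h3, Matrix.det_mul, Matrix.det_mul, Matrix.det_transpose, norm_mul, norm_mul]
  field_simp

/-- A null vector of the matrix gives a `y` in the span of the second part of the basis which lies
in the kernel of `g`, hence in the span of the first part, so `y = 0`. -/
theorem det_ne_zero_of_adapted {g : E →ₗ[ℂ] E →ₗ[ℂ] F} (hg : ∀ a b, g a b = g b a) {k r : ℕ}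
    {b : Fin k ⊕ Fin r → E} (hb : LinearIndependent ℂ b)
    (hbs : Submodule.span ℂ (Set.range b) = ⊤)
    (hbK : Submodule.span ℂ (Set.range fun a => b (Sum.inl a)) = LinearMap.ker g)
    {lam : F →ₗ[ℂ] ℂ} (hlam : Function.Injective lam) :
    (Matrix.of fun i j => lam (g (b (Sum.inr i)) (b (Sum.inr j)))).det ≠ 0 := by
  intro hdet
  obtain ⟨v, hv, hv0⟩ := Matrix.exists_mulVec_eq_zero_iff.2 hdet
  set y := ∑ j, v j • b (Sum.inr j) with hy
  have h1 : ∀ i, g y (b i) = 0 := by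
    rintro (i | i)
    · have : b (Sum.inl i) ∈ LinearMap.ker g := hbK ▸ Submodule.subset_span ⟨i, rfl⟩
      rw [hg, LinearMap.mem_ker.1 this, LinearMap.zero_apply]
    · rw [hg]
      apply hlam
      have := congrFun hv0 i
      simp only [Matrix.mulVec, dotProduct, Matrix.of_apply, Pi.zero_apply] at this
      rw [hy, map_sum, map_sum, map_zero, ← this]
      refine Finset.sum_congr rfl fun j _ => ?_
      rw [map_smul, map_smul, smul_eq_mul, mul_comm]
  have h2 : y ∈ LinearMap.ker g := by
    rw [LinearMap.mem_ker]
    exact LinearMap.ext_on_range hbs h1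
  rw [← hbK] at h2
  obtain ⟨-, hr, hdisj⟩ := linearIndependent_sum.1 hb
  have h3 : y ∈ Submodule.span ℂ (Set.range (b ∘ Sum.inr)) :=
    Submodule.sum_mem _ fun j _ => Submodule.smul_mem _ _ (Submodule.subset_span ⟨j, rfl⟩)
  have h4 : y = 0 := (Submodule.disjoint_def.1 hdisj) y h2 h3
  exact hv (funext (Fintype.linearIndependent_iff.1 hr v h4))

end AdaptedBasis

/-! ### Frames of `V` adapted to the saturated kernel. -/

namespace QuadricBundle

open Filter Topology HolomorphicVectorBundle Matrix

variable {X : Type u} [TopologicalSpace X] [ChartedSpace ℂ X] [IsManifold 𝓘(ℂ, ℂ) ω X]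
  [ConnectedSpace X] {L : HolomorphicVectorBundle.{u, w} X 1} {n : ℕ}

/-- `b` is a basis of the fibre at `x` which begins with a basis of the saturated kernel. -/
structure IsAdapted (Q : QuadricBundle.{u, v, w} L n) (x : X)
    (b : Fin Q.kernelBundle.rank ⊕ Fin Q.rankγ → Q.V.Fiber x) : Prop where
  linearIndependent : LinearIndependent ℂ b
  span_inl : Submodule.span ℂ (Set.range fun a => b (Sum.inl a)) = Q.kernelFiber x

theorem IsAdapted.span_eq_top {Q : QuadricBundle.{u, v, w} L n} {x : X}
    {b : Fin Q.kernelBundle.rank ⊕ Fin Q.rankγ → Q.V.Fiber x} (hb : Q.IsAdapted x b) :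
    Submodule.span ℂ (Set.range b) = ⊤ := by
  have := finiteDimensional_fiber (V := Q.V) x
  refine hb.linearIndependent.span_eq_top_of_card_eq_finrank' ?_
  rw [finrank_fiber, Fintype.card_sum, Fintype.card_fin, Fintype.card_fin,
    Q.kernelBundle_rank_add_rankγ]

/-- Near every point there is a holomorphic frame of `V` which begins with a frame of the
saturated kernel. -/
theorem exists_adapted_frame (Q : QuadricBundle.{u, v, w} L n) (x₀ : X) :
    ∃ (b : Fin Q.kernelBundle.rank ⊕ Fin Q.rankγ → ∀ x, Q.V.Fiber x) (U : Set X), x₀ ∈ U ∧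
      IsOpen U ∧ (∀ a, Q.V.IsHolomorphicOn (b a) U) ∧
      ∀ x ∈ U, Q.IsAdapted x fun a => b a x := by
  obtain ⟨t, U, hxU, ht⟩ := Q.kernelBundle.exists_frame x₀
  set y : Fin Q.kernelBundle.rank → Fin n → ℂ := fun a => Q.V.coord x₀ x₀ (t a x₀) with hy
  have hyi : LinearIndependent ℂ y := (ht.linearIndependent x₀ hxU).map' _
    (LinearMap.ker_eq_bot.2 (Q.V.coord_injective (Q.V.mem_baseSet x₀)))
  -- The frame of the kernel is completed at `x₀` by vectors with constant coordinates in the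
  -- trivialization; independence is an open condition.
  obtain ⟨C, hC⟩ := Submodule.exists_isCompl (Submodule.span ℂ (Set.range y))
  have hCr : Module.finrank ℂ C = Q.rankγ := by
    have h1 := Submodule.finrank_add_eq_of_isCompl hC
    rw [finrank_span_eq_card hyi, Fintype.card_fin, Module.finrank_fin_fun] at h1
    have h2 := Q.kernelBundle_rank_add_rankγ
    omega
  set c : Fin Q.rankγ → Fin n → ℂ := fun j => (Module.finBasisOfFinrankEq ℂ C hCr j : Fin n → ℂ)
    with hc
  have hci : LinearIndependent ℂ c :=
    (Module.finBasisOfFinrankEq ℂ C hCr).linearIndependent.map' C.subtype C.ker_subtype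
  have hcC : Submodule.span ℂ (Set.range c) ≤ C := by
    rw [Submodule.span_le]
    rintro _ ⟨j, rfl⟩
    exact Subtype.coe_prop _
  have hyc : LinearIndependent ℂ (Sum.elim y c) := hyi.sum_type hci (hC.disjoint.mono_right hcC)
  set b : Fin Q.kernelBundle.rank ⊕ Fin Q.rankγ → ∀ x, Q.V.Fiber x :=
    Sum.elim t fun j x => Q.V.vec x₀ x (c j) with hb
  set U' := U ∩ Q.V.baseSet x₀ with hU'
  have hU'o : IsOpen U' := ht.isOpen.inter (Q.V.isOpen_baseSet x₀)
  have hxU' : x₀ ∈ U' := ⟨hxU, Q.V.mem_baseSet x₀⟩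
  have hbhol : ∀ a, Q.V.IsHolomorphicOn (b a) U' := by
    rintro (a | a)
    · exact (ht.holomorphic a).mono Set.inter_subset_left
    · exact (isHolomorphicOn_vec x₀ (c a)).mono Set.inter_subset_right
  have hcont : ContinuousAt (fun x a => Q.V.coord x₀ x (b a x)) x₀ :=
    continuousAt_pi.2 fun a =>
      (contMDiffAt_coord hU'o (hbhol a) hxU' (Q.V.mem_baseSet x₀)).continuousAt
  have h0 : (fun a => Q.V.coord x₀ x₀ (b a x₀)) = Sum.elim y c := by
    funext a
    rcases a with a | a
    · rfl
    · exact Q.V.coord_vec (Q.V.mem_baseSet x₀) _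
  have hi₀ : LinearIndependent ℂ fun a => Q.V.coord x₀ x₀ (b a x₀) := by
    rw [h0]
    exact hyc
  have hev : ∀ᶠ x in 𝓝 x₀, LinearIndependent ℂ fun a => Q.V.coord x₀ x (b a x) :=
    hcont.eventually (p := fun f => LinearIndependent ℂ f) hi₀.eventually
  obtain ⟨U'', hU'', hU''o, hxU''⟩ := eventually_nhds_iff.1 hev
  refine ⟨b, U' ∩ U'', ⟨hxU', hxU''⟩, hU'o.inter hU''o,
    fun a => (hbhol a).mono Set.inter_subset_left, fun x hx => ⟨?_, ?_⟩⟩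
  · exact LinearIndependent.of_comp (Q.V.coord x₀ x) (hU'' x hx.2)
  · exact ht.span_eq x hx.1.1

theorem exists_isAdapted (Q : QuadricBundle.{u, v, w} L n) (x : X) : ∃ b, Q.IsAdapted x b := by
  obtain ⟨b, U, hxU, -, -, h⟩ := Q.exists_adapted_frame x
  exact ⟨_, h x hxU⟩

end QuadricBundle

/-! ### Coordinates on a line bundle. -/

namespace HolomorphicVectorBundle

variable {X : Type u} [TopologicalSpace X] [ChartedSpace ℂ X]

/-- The coordinate of a line bundle in the trivialization around `x₀`. -/
noncomputable def lineCoord (L : HolomorphicVectorBundle.{u, w} X 1) (x₀ x : X) :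
    L.Fiber x →ₗ[ℂ] ℂ := LinearMap.proj 0 ∘ₗ L.coord x₀ x

/-- The unit vector of a line bundle in the trivialization around `x₀`. -/
noncomputable def lineVec (L : HolomorphicVectorBundle.{u, w} X 1) (x₀ x : X) : L.Fiber x :=
  L.vec x₀ x fun _ => 1

theorem lineCoord_injective (L : HolomorphicVectorBundle.{u, w} X 1) {x₀ x : X}
    (hx : x ∈ L.baseSet x₀) : Function.Injective (L.lineCoord x₀ x) := by
  intro a b hab
  apply L.coord_injective hx
  ext i
  obtain rfl : i = 0 := Subsingleton.elim _ _
  exact hab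

theorem eq_lineCoord_smul_lineVec (L : HolomorphicVectorBundle.{u, w} X 1) {x₀ x : X}
    (hx : x ∈ L.baseSet x₀) (y : L.Fiber x) : y = L.lineCoord x₀ x y • L.lineVec x₀ x := by
  apply L.lineCoord_injective hx
  simp [lineCoord, lineVec, L.coord_vec hx]

theorem isHolomorphicFrame_lineVec (L : HolomorphicVectorBundle.{u, w} X 1) (x₀ : X) :
    L.IsHolomorphicFrame L.whole.carrier (fun _ : Fin 1 => L.lineVec x₀) (L.baseSet x₀) where
  isOpen := L.isOpen_baseSet x₀
  holomorphic _ := isHolomorphicOn_vec x₀ _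
  linearIndependent x hx := by
    rw [linearIndependent_unique_iff]
    intro h
    have h1 := L.coord_vec hx fun _ => 1
    have h2 : L.vec x₀ x (fun _ => 1) = 0 := h
    rw [h2, map_zero] at h1
    exact zero_ne_one (congrFun h1 0)
  span_eq x hx := by
    refine top_le_iff.1 fun y _ => ?_
    rw [L.eq_lineCoord_smul_lineVec hx y]
    exact Submodule.smul_mem _ _ (Submodule.subset_span ⟨0, rfl⟩)

end HolomorphicVectorBundle

/-! ### The discriminant as a section, and the degree bounds. -/

namespace QuadricBundle

open Filter Topology HolomorphicVectorBundle Matrix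

variable {X : Type u} [TopologicalSpace X] [ChartedSpace ℂ X] [IsManifold 𝓘(ℂ, ℂ) ω X]
  [ConnectedSpace X] {L : HolomorphicVectorBundle.{u, w} X 1} {n : ℕ}

/-- The squared norm of the discriminant of the form that `γ` induces on the quotient of `V` by
the saturation of its kernel. -/
noncomputable def discriminant (Q : QuadricBundle.{u, v, w} L n) (h : Q.V.HermitianMetric)
    (m : L.HermitianMetric) (x : X) : ℝ :=
  discriminantNorm (h.form x) (m.form x) (Q.γ x) (Q.exists_isAdapted x).choose
    (L.lineVec x x) (L.lineCoord x x)

theorem discriminant_eq (Q : QuadricBundle.{u, v, w} L n) (h : Q.V.HermitianMetric)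
    (m : L.HermitianMetric) {x₀ x : X} (hx : x ∈ L.baseSet x₀)
    {b : Fin Q.kernelBundle.rank ⊕ Fin Q.rankγ → Q.V.Fiber x} (hb : Q.IsAdapted x b) :
    Q.discriminant h m x = discriminantNorm (h.form x) (m.form x) (Q.γ x) b
      (L.lineVec x₀ x) (L.lineCoord x₀ x) := by
  have hb' := (Q.exists_isAdapted x).choose_spec
  rw [discriminant, discriminantNorm_change_basis (m.form x) (h.conj_symm x) (h.pos x) (Q.symm x)
    (Q.kernelFiber_le_ker x) hb'.linearIndependent hb.span_eq_top hb.span_inl hb'.span_inl,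
    discriminantNorm_change_coordinate _ _ _ _ (L.eq_lineCoord_smul_lineVec hx)
      (L.eq_lineCoord_smul_lineVec (L.mem_baseSet x))]

/-- The first Chern form of `L ^ r ⊗ (det (V / N)) ^ (-2)`, up to a factor, where `N` is the
saturated kernel of `γ`. -/
noncomputable def discriminantForm (Q : QuadricBundle.{u, v, w} L n) (h : Q.V.HermitianMetric)
    (m : L.HermitianMetric) (p : X) (z : ℂ) : ℝ :=
  -(4 * Real.pi) * (2 * Q.kernelBundle.chernCoeff h p z + (-2) * Q.V.whole.chernCoeff h p z +
    Q.rankγ * L.whole.chernCoeff m p z)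

theorem isHolomorphicFrame_whole_of_adapted (Q : QuadricBundle.{u, v, w} L n)
    {b : Fin Q.kernelBundle.rank ⊕ Fin Q.rankγ → ∀ x, Q.V.Fiber x} {U : Set X} (hU : IsOpen U)
    (hb : ∀ a, Q.V.IsHolomorphicOn (b a) U) (hbU : ∀ x ∈ U, Q.IsAdapted x fun a => b a x)
    (σ : Fin n ≃ Fin Q.kernelBundle.rank ⊕ Fin Q.rankγ) :
    Q.V.IsHolomorphicFrame Q.V.whole.carrier (fun i => b (σ i)) U where
  isOpen := hU
  holomorphic i := hb (σ i)
  linearIndependent x hx := (hbU x hx).linearIndependent.comp σ σ.injective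
  span_eq x hx := by
    have h1 : Set.range (fun i => b (σ i) x) = Set.range fun a => b a x :=
      σ.surjective.range_comp fun a => b a x
    rw [h1, (hbU x hx).span_eq_top]
    rfl

/-- In an adapted holomorphic frame, `G` is the determinant of the form on the complementary
vectors, and the weight is assembled from the logarithms of the Gram determinants of `N`, `V` and
`L` with factors `2`, `-2` and `r`. -/
theorem isSingularPotential_discriminant (Q : QuadricBundle.{u, v, w} L n)
    (h : Q.V.HermitianMetric) (m : L.HermitianMetric) :
    IsSingularPotential (Q.discriminant h m) (Q.discriminantForm h m) := by
  intro p z₀ hz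
  set x₀ := (chartAt ℂ p).symm z₀ with hx₀
  obtain ⟨b, U, hxU, hU, hbhol, hb⟩ := Q.exists_adapted_frame x₀
  have hL := L.isHolomorphicFrame_lineVec x₀
  have hxL : x₀ ∈ L.baseSet x₀ := L.mem_baseSet x₀
  have hN : Q.V.IsHolomorphicFrame Q.kernelBundle.carrier (fun a => b (Sum.inl a)) U :=
    ⟨hU, fun a => hbhol _, fun x hx => (hb x hx).linearIndependent.comp _ Sum.inl_injective,
      fun x hx => (hb x hx).span_inl⟩
  obtain ⟨σ⟩ : Nonempty (Fin n ≃ Fin Q.kernelBundle.rank ⊕ Fin Q.rankγ) :=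
    ⟨Fintype.equivOfCardEq (by simp [Q.kernelBundle_rank_add_rankγ])⟩
  have hV := Q.isHolomorphicFrame_whole_of_adapted hU hbhol hb σ
  have hCN := contDiffAt_log_gramDeterminant h hN hz hxU
  have hCV := contDiffAt_log_gramDeterminant h hV hz hxU
  have hCL := contDiffAt_log_gramDeterminant m hL hz hxL
  set WN : ℂ → ℝ := fun y => Real.log (gramDeterminant (h.form ((chartAt ℂ p).symm y))
    fun a => b (Sum.inl a) ((chartAt ℂ p).symm y)) with hWN
  set WV : ℂ → ℝ := fun y => Real.log (gramDeterminant (h.form ((chartAt ℂ p).symm y))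
    fun a => b (σ a) ((chartAt ℂ p).symm y)) with hWV
  set WL : ℂ → ℝ := fun y => Real.log (gramDeterminant (m.form ((chartAt ℂ p).symm y))
    fun _ : Fin 1 => L.lineVec x₀ ((chartAt ℂ p).symm y)) with hWL
  have hevU : ∀ᶠ y in 𝓝 z₀, (chartAt ℂ p).symm y ∈ U :=
    ((chartAt ℂ p).continuousAt_symm hz).eventually (hU.mem_nhds hxU)
  have hevL : ∀ᶠ y in 𝓝 z₀, (chartAt ℂ p).symm y ∈ L.baseSet x₀ :=
    ((chartAt ℂ p).continuousAt_symm hz).eventually ((L.isOpen_baseSet x₀).mem_nhds hxL)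
  have hC1 : ContDiffAt ℝ 2 ((2 : ℝ) • WN) z₀ := hCN.const_smul (2 : ℝ)
  have hC2 : ContDiffAt ℝ 2 ((-2 : ℝ) • WV) z₀ := hCV.const_smul (-2 : ℝ)
  have hC3 : ContDiffAt ℝ 2 ((Q.rankγ : ℝ) • WL) z₀ := hCL.const_smul (Q.rankγ : ℝ)
  have hC12 : ContDiffAt ℝ 2 ((2 : ℝ) • WN + (-2 : ℝ) • WV) z₀ := hC1.add hC2
  refine ⟨fun y => (Matrix.of fun i j => L.lineCoord x₀ ((chartAt ℂ p).symm y)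
      (Q.γ ((chartAt ℂ p).symm y) (b (Sum.inr i) ((chartAt ℂ p).symm y))
        (b (Sum.inr j) ((chartAt ℂ p).symm y)))).det,
    (2 : ℝ) • WN + (-2 : ℝ) • WV + (Q.rankγ : ℝ) • WL, ?_, hC12.add hC3, ?_, ?_, ?_⟩
  · refine analyticAt_det fun i j => ?_
    have h1 := Q.holomorphic U _ _ hU (hbhol (Sum.inr i)) (hbhol (Sum.inr j))
    exact analyticAt_pi_iff.1 (analyticAt_coord hU h1 hz hxU hxL) 0
  -- Off `x₀` the saturated kernel is the full kernel, so the induced form is nondegenerate there.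
  · filter_upwards [(tendsto_chartAt_symm_punctured hz).eventually
      (Q.eventually_kernelFiber_eq_ker x₀), hevU.filter_mono nhdsWithin_le_nhds,
      hevL.filter_mono nhdsWithin_le_nhds] with y h1 h2 h3
    exact det_ne_zero_of_adapted (Q.symm _) (hb _ h2).linearIndependent (hb _ h2).span_eq_top
      ((hb _ h2).span_inl.trans h1) (L.lineCoord_injective h3)
  · filter_upwards [hevU, hevL] with y h2 h3
    rw [Q.discriminant_eq h m h3 (hb _ h2), discriminantNorm]
    have e1 := Real.exp_log (gramDeterminant_form_pos h (hN.linearIndependent _ h2))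
    have e2 := Real.exp_log (gramDeterminant_form_pos h (hV.linearIndependent _ h2))
    have e3 := Real.exp_log (gramDeterminant_form_pos m (hL.linearIndependent _ h3))
    have e4 : (gramDeterminant (h.form ((chartAt ℂ p).symm y))
      fun a => b a ((chartAt ℂ p).symm y)) = gramDeterminant (h.form ((chartAt ℂ p).symm y))
        fun a => b (σ a) ((chartAt ℂ p).symm y) :=
      (gramDeterminant_reindex _ σ fun a => b a ((chartAt ℂ p).symm y)).symm
    rw [e4]
    simp only [Pi.add_apply, Pi.smul_apply, smul_eq_mul, hWN, hWV, hWL]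
    rw [Real.exp_add, Real.exp_add, Real.exp_nat_mul, neg_mul, Real.exp_neg, two_mul, two_mul,
      Real.exp_add, Real.exp_add, e1, e2, e3]
    field_simp
  · filter_upwards [Q.kernelBundle.chernCoeff_eventuallyEq h hN hz hxU,
      Q.V.whole.chernCoeff_eventuallyEq h hV hz hxU,
      L.whole.chernCoeff_eventuallyEq m hL hz hxL,
      hC12.laplacian_add_nhds hC3, hC1.laplacian_add_nhds hC2,
      InnerProductSpace.laplacian_smul_nhds (2 : ℝ) hCN,
      InnerProductSpace.laplacian_smul_nhds (-2 : ℝ) hCV,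
      InnerProductSpace.laplacian_smul_nhds (Q.rankγ : ℝ) hCL] with y k1 k2 k3 k4 k5 k6 k7 k8
    change _ = -(1 / (4 * Real.pi)) * Laplacian.laplacian WN y at k1
    change _ = -(1 / (4 * Real.pi)) * Laplacian.laplacian WV y at k2
    change _ = -(1 / (4 * Real.pi)) * Laplacian.laplacian WL y at k3
    rw [discriminantForm, k1, k2, k3, k4, Pi.add_apply, k5, Pi.add_apply, k6, k7, k8]
    simp only [Pi.smul_apply, smul_eq_mul]
    have := Real.pi_pos.ne'
    field_simp
    ring

variable [CompactSpace X] [T2Space X]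

/-- The discriminant of the form which `γ` induces on the quotient of `V` by its saturated kernel
is a non-zero section of `L ^ r ⊗ (det (V / N)) ^ (-2)`, so that this line bundle has
non-negative degree. -/
theorem two_mul_degree_le (Q : QuadricBundle.{u, v, w} L n) :
    2 * Q.degree ≤ Q.rankγ * L.degree + 2 * Q.kernelBundle.degree := by
  obtain ⟨h⟩ := Q.V.nonempty_hermitianMetric
  obtain ⟨m⟩ := L.nonempty_hermitianMetric
  obtain ⟨ρ, hρ⟩ := exists_partition_isSubordinate_chartAt (X := X)
  have h1 := (Q.isSingularPotential_discriminant h m).chartIntegral_nonpos hρ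
  have hN := Q.kernelBundle.continuousOn_chernCoeff h
  have hV := Q.V.whole.continuousOn_chernCoeff h
  have hL := L.whole.continuousOn_chernCoeff m
  have hN2 : ∀ p : X, ContinuousOn (fun z => 2 * Q.kernelBundle.chernCoeff h p z)
      (chartAt ℂ p).target := fun p => continuousOn_const.mul (hN p)
  have hNV : ∀ p : X, ContinuousOn (fun z => 2 * Q.kernelBundle.chernCoeff h p z +
      (-2) * Q.V.whole.chernCoeff h p z) (chartAt ℂ p).target := fun p =>
    (hN2 p).add (continuousOn_const.mul (hV p))
  unfold discriminantForm at h1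
  rw [chartIntegral_const_mul, chartIntegral_add_const_mul hρ _ hNV hL,
    chartIntegral_add_const_mul hρ _ hN2 hV, chartIntegral_const_mul] at h1
  have h2 : 0 < 4 * Real.pi := by have := Real.pi_pos; positivity
  rw [neg_mul, neg_nonpos] at h1
  have h3 := (mul_nonneg_iff_of_pos_left h2).1 h1
  rw [QuadricBundle.degree, HolomorphicVectorBundle.degree, HolomorphicVectorBundle.degree,
    Q.V.whole.degree_eq_chernIntegral h hρ, L.whole.degree_eq_chernIntegral m hρ,
    Q.kernelBundle.degree_eq_chernIntegral h hρ]
  simp only [Subbundle.chernIntegral_eq]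
  linarith

/-- The Gram determinant of the empty family is `1`, whose logarithm vanishes. -/
theorem degree_eq_zero_of_rank_eq_zero {V : HolomorphicVectorBundle.{u, v} X n} (W : V.Subbundle)
    (hW : W.rank = 0) : W.degree = 0 := by
  obtain ⟨h⟩ := V.nonempty_hermitianMetric
  obtain ⟨ρ, hρ⟩ := exists_partition_isSubordinate_chartAt (X := X)
  have hempty : IsEmpty (Fin W.rank) := by rw [hW]; infer_instance
  have h1 : ∀ p z, W.chernCoeff h p z = 0 := fun p z => by
    simp [Subbundle.chernCoeff, Subbundle.gramDet]
  rw [W.degree_eq_chernIntegral h hρ, Subbundle.chernIntegral]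
  simp [h1]

theorem isProper_kernelBundle (Q : QuadricBundle.{u, v, w} L n) (h : 0 < Q.kernelBundle.rank) :
    Q.IsProper Q.kernelBundle := by
  have hx := Classical.arbitrary X
  constructor
  · refine bot_lt_iff_ne_bot.2 fun h0 => ?_
    have h1 := Q.finrank_kernelFiber_eq_rank hx
    have h2 : Q.kernelFiber hx = ⊥ := congrFun h0 hx
    rw [h2, finrank_bot] at h1
    omega
  · refine lt_top_iff_ne_top.2 fun h0 => ?_
    have h1 := Q.finrank_kernelFiber_eq_rank hx
    have h2 : Q.kernelFiber hx = ⊤ := congrFun h0 hx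
    rw [h2, finrank_top, finrank_fiber] at h1
    have := Q.kernelBundle_rank_add_rankγ
    have := Q.rankγ_pos
    omega

theorem mapsToZero_kernelBundle (Q : QuadricBundle.{u, v, w} L n) :
    Q.MapsToZero Q.kernelBundle := fun x =>
  LinearMap.le_ker_iff_map.1 (Q.kernelFiber_le_ker x)

/-- This is condition (1c) for the saturated kernel. The condition speaks of proper non-zero
subbundles only: rank zero is treated apart, and the kernel is not all of `V` because `γ ≠ 0`. -/
theorem kernelBundle_degree_le {Q : QuadricBundle.{u, v, w} L n} {α : ℝ} (hQ : Q.IsSemistable α) :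
    Q.kernelBundle.degree ≤ α * Q.kernelBundle.rank := by
  rcases Nat.eq_zero_or_pos Q.kernelBundle.rank with h | h
  · rw [degree_eq_zero_of_rank_eq_zero _ h, h]
    simp
  · exact (hQ.2.1 _ (Q.isProper_kernelBundle h)).2.2 Q.mapsToZero_kernelBundle

/-- The bounds on the degree of a semistable quadric bundle. -/
theorem IsSemistable.degree_bounds {Q : QuadricBundle.{u, v, w} L n} {α : ℝ}
    (hQ : Q.IsSemistable α) :
    n * α ≤ Q.degree ∧ Q.degree ≤ Q.rankγ * L.degree / 2 + ((n : ℝ) - Q.rankγ) * α := by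
  have hr := Q.rankγ_pos
  have hkr := Q.kernelBundle_rank_add_rankγ
  have hkr' : (Q.kernelBundle.rank : ℝ) + Q.rankγ = n := by exact_mod_cast hkr
  have hn : (0 : ℝ) < n := by exact_mod_cast (by omega : 0 < n)
  constructor
  · have := (le_div_iff₀ hn).1 hQ.1
    linarith
  · have h1 := Q.two_mul_degree_le
    have h2 := kernelBundle_degree_le hQ
    have h3 : (n : ℝ) - Q.rankγ = Q.kernelBundle.rank := by linarith
    rw [h3]
    linarith

theorem isEmpty_moduliSpace {α : ℝ} {d : ℤ}
    (h : ∀ Q : QuadricBundle.{u, v, w} L n, Q.degree = d → ¬ Q.IsSemistable α) :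
    IsEmpty (ModuliSpace.{u, v, w} L α n d) :=
  ⟨fun q => Quotient.inductionOn q fun Q => h Q.1 Q.2.1 Q.2.2.1⟩

end QuadricBundle

/-! ### The proposition. -/

theorem mainTheorem3 {X : Type u} [TopologicalSpace X] [T2Space X] [CompactSpace X]
    [ConnectedSpace X] [ChartedSpace ℂ X] [IsManifold 𝓘(ℂ, ℂ) ω X]
    (L : HolomorphicVectorBundle.{u, w} X 1) (α : ℝ) :
    (∀ (n : ℕ) (Q : QuadricBundle.{u, v, w} L n), Q.IsSemistable α →
      n * α ≤ Q.degree ∧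
      Q.degree ≤ Q.rankγ * L.degree / 2 + ((n : ℝ) - Q.rankγ) * α) ∧
    (L.degree / 2 < α → ∀ (n : ℕ) (d : ℤ),
      (∀ Q : QuadricBundle.{u, v, w} L n, Q.degree = d → ¬ Q.IsSemistable α) ∧
      IsEmpty (QuadricBundle.ModuliSpace.{u, v, w} L α n d)) ∧
    (α ≤ L.degree / 2 → ∀ (n : ℕ) (d : ℤ), n * L.degree / 2 < d →
      (∀ Q : QuadricBundle.{u, v, w} L n, Q.degree = d → ¬ Q.IsSemistable α) ∧
      IsEmpty (QuadricBundle.ModuliSpace.{u, v, w} L α n d)) := by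
  refine ⟨fun n Q hQ => hQ.degree_bounds, fun hα n d => ?_, fun hα n d hd => ?_⟩
  · have h : ∀ Q : QuadricBundle.{u, v, w} L n, Q.degree = d → ¬ Q.IsSemistable α := by
      intro Q _ hQ
      obtain ⟨h1, h2⟩ := hQ.degree_bounds
      have hr : (0 : ℝ) < Q.rankγ := by exact_mod_cast Q.rankγ_pos
      -- The two bounds together give `r α ≤ r d_L / 2`, which is impossible since `r > 0`.
      nlinarith [mul_lt_mul_of_pos_left hα hr]
    exact ⟨h, QuadricBundle.isEmpty_moduliSpace h⟩
  · have h : ∀ Q : QuadricBundle.{u, v, w} L n, Q.degree = d → ¬ Q.IsSemistable α := by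
      intro Q hQd hQ
      obtain ⟨-, h2⟩ := hQ.degree_bounds
      have hkr' : (Q.kernelBundle.rank : ℝ) + Q.rankγ = n := by
        exact_mod_cast Q.kernelBundle_rank_add_rankγ
      have hk : (0 : ℝ) ≤ Q.kernelBundle.rank := Nat.cast_nonneg _
      -- As `n - r` is a rank, it is non-negative, so `α` may be replaced by `d_L / 2` in the upper
      -- bound, which becomes `n d_L / 2`.
      have h3 : ((n : ℝ) - Q.rankγ) * α ≤ ((n : ℝ) - Q.rankγ) * (L.degree / 2) :=
        mul_le_mul_of_nonneg_left hα (by linarith)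
      rw [hQd] at h2
      linarith
    exact ⟨h, QuadricBundle.isEmpty_moduliSpace h⟩
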